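/- Let $m\ge 1$. For a symmetric $m\times m$ matrix $A$ let $\mathrm{vecs}(A)$ be the vector of the entries of its lower triangular part, with first entry $a_{11}$, let $\underline{\mathrm{vecs}}(A)$ be $\mathrm{vecs}(A)$ without $a_{11}$, and let $D_m$ be the duplication matrix, $D_m\,\mathrm{vecs}(A)=\mathrm{vec}(A)$. Let $S$ be a scale functional: a positive function on the positive definite matrices with $S(c\Sigma)=cS(\Sigma)$ for $c>0$ and $S(I_m)=1$, which is differentiable in the free entries of $\Sigma$ with $\partial S/\partial\Sigma_{11}\neq 0$. A shape matrix is a positive definite $V$ with $S(V)=1$; near a given shape matrix, $V_{11}$ is a function of $v=\underline{\mathrm{vecs}}(V)$. Put $$K_V=\begin{pmatrix}\nabla_v^T V_{11}\\ I\end{pmatrix},\qquad M_S^V=K_V^TD_m^T .$$ Let $\delta_m=\pi^{-m/2}\Gamma(m/2)$, let $\mathcal G$ be the set of functions $g:(0,\infty)\to[0,\infty)$ with $\int_0^\infty t^{m/2-1}g(t)\,dt=\delta_m$, and let $\bar{\mathcal G}$ be the set of $\bar g\in\mathcal G$ with $\delta_m^{-1}\int_0^\infty q^{m/2}\bar g(q)\,dq=m$.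 With $\gamma=(\mu^T,\underline{\mathrm{vecs}}(V)^T)^T$, consider the unconstrained model $\mathcal P_{\gamma,g}$ of the densities on $\mathbb R^m$ $$|V|^{-1/2}g\big((x-\mu)^TV^{-1}(x-\mu)\big),\quad g\in\mathcal G,$$ and the constrained model $\mathcal P_{\eta,\bar g}$, $\eta=(\gamma^T,s)^T$, of the densities $$s^{-m/2}|V|^{-1/2}\bar g\big(s^{-1}(x-\mu)^TV^{-1}(x-\mu)\big),\quad s>0,\ \bar g\in\bar{\mathcal G}.$$ Fix $\mu_0\in\mathbb R^m$, a shape matrix $V_0$, $s_0>0$ and $\bar g_0\in\bar{\mathcal G}$ that is $C^1$ on $(0,\infty)$; put $g_0(t)=s_0^{-m/2}\bar g_0(t/s_0)$ and $\gamma_0=(\mu_0^T,\underline{\mathrm{vecs}}(V_0)^T)^T$, so that both models have the same true distribution $P_0$. Let $\mathcal Q$ have density $\delta_m^{-1}q^{m/2-1}\bar g_0(q)$ on $(0,\infty)$, let $\bar\varphi_0=-2\bar g_0'/\bar g_0$, and $$\alpha=\frac{E\{\mathcal Q^2\bar\varphi_0(\mathcal Q)^2\}}{m(m+2)},\qquad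 \beta=\frac{E\{\mathcal Q\bar\varphi_0(\mathcal Q)^2\}}{m}.$$ A score is the gradient of the log-density at the true parameter. The nuisance tangent space of the scale is the span in $L^2(P_0)$ of its score; that of $g_0$ (of $\bar g_0$) is the closed linear span in $L^2(P_0)$ of the scores of all regular finite-dimensional parametric submodels of the model in which only $g\in\mathcal G$ (only $\bar g\in\bar{\mathcal G}$) varies. Here a submodel $\rho\mapsto q_\rho$ with $q_{\rho_0}=p_0$ is regular if it is differentiable at $\rho_0$ for $P_0$-almost every $x$ and, for some $b\in L^2(P_0)$ and all $\rho$ near $\rho_0$, $|q_\rho-p_0|\le\|\rho-\rho_0\|\,b\,p_0$ $P_0$-almost everywhere. The efficient information matrix of $\gamma_0$ in the presence of nuisances is $E_0\{\bar s\bar s^T\}$, where $\bar s$ is the score of $\gamma$ minus its componentwise $L^2(P_0)$-orthogonal projection onto the sum of the nuisance tangent spaces. Assume that $E\{\mathcal Q^2\}$, $\alpha$ and $\beta$ are finite. Then the scores of $\gamma$ (in both models) and of $s$ are square-integrable with zero mean under $P_0$, and the following three information matrices coincide: the efficient semiparametric one $\bar I(\gamma_0|g_0)$ in $\mathcal P_{\gamma,g}$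 (nuisance $g_0$), the efficient semiparametric one $\bar I(\gamma_0|s_0,\bar g_0)$ in $\mathcal P_{\eta,\bar g}$ (nuisances $s_0$ and $\bar g_0$), and the efficient parametric one $\bar I(\gamma_0|s_0)$ (nuisance $s_0$ only, $\bar g_0$ known). Their common value is $$\mathrm{blkdiag}\big(I_{\mu_0},\bar I_{V_0}\big),\qquad I_{\mu_0}=\beta\,(s_0V_0)^{-1},$$ $$\bar I_{V_0}=\tfrac12\,\alpha\,M_S^{V_0}\Big[(V_0^{-1}\otimes V_0^{-1})-m^{-1}\,\mathrm{vec}(V_0^{-1})\,\mathrm{vec}(V_0^{-1})^T\Big]\big(M_S^{V_0}\big)^T .$$ -/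

import Mathlib

open MeasureTheory Set Filter Topology
open scoped Kronecker Matrix

noncomputable section

namespace Elliptical

/-! ### Half-vectorization and the duplication matrix -/

/-- Positions `(i, j)` with `j ≤ i` of the lower triangular part of an `m × m` matrix:
the index set of `vecs A`, which has `m (m + 1) / 2` elements. -/
abbrev VechIdx (m : ℕ) : Type := {p : Fin m × Fin m // p.2 ≤ p.1}

/-- The same positions with the top-left one removed: the index set of `vecs A` deprived of its
first entry. -/
abbrev OffIdx (m : ℕ) [NeZero m] : Type := {p : Fin m × Fin m // p.2 ≤ p.1 ∧ p ≠ (0, 0)}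

/-- The top-left position. -/
def topIdx (m : ℕ) [NeZero m] : VechIdx m := ⟨(0, 0), le_refl _⟩

/-- The lower triangular position that carries the `(i, j)` entry of a symmetric matrix. -/
def lowIdx {m : ℕ} (i j : Fin m) : VechIdx m := ⟨(max i j, min i j), min_le_max⟩

/-- `vecs A`, the entries of the lower triangular part. -/
def vecs {m : ℕ} (A : Matrix (Fin m) (Fin m) ℝ) : VechIdx m → ℝ := fun k => A k.1.1 k.1.2

/-- `vecs A` without its first entry `A₁₁`. -/
def ovecs {m : ℕ} [NeZero m] (A : Matrix (Fin m) (Fin m) ℝ) : OffIdx m → ℝ :=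
  fun k => A k.1.1 k.1.2

/-- The symmetric matrix with a given `vecs`. -/
def symMat {m : ℕ} (c : VechIdx m → ℝ) : Matrix (Fin m) (Fin m) ℝ :=
  Matrix.of fun i j => c (lowIdx i j)

/-- The vector `(a, vᵀ)ᵀ` with first (top-left) entry `a`. -/
def consTop {m : ℕ} [NeZero m] (a : ℝ) (v : OffIdx m → ℝ) : VechIdx m → ℝ :=
  fun k => if h : k.1 = (0, 0) then a else v ⟨k.1, k.2, h⟩

/-- The duplication matrix `D_m`. -/
def dupMat (m : ℕ) : Matrix (Fin m × Fin m) (VechIdx m) ℝ :=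
  Matrix.of fun p k => if k = lowIdx p.1 p.2 then 1 else 0

theorem symMat_vecs {m : ℕ} {A : Matrix (Fin m) (Fin m) ℝ} (hA : A.IsSymm) :
    symMat (vecs A) = A := by
  ext i j
  rcases le_total i j with h | h
  · simp [symMat, vecs, lowIdx, h, hA.apply]
  · simp [symMat, vecs, lowIdx, h]

/-- The defining property of the duplication matrix. -/
theorem dupMat_mulVec_vecs {m : ℕ} {A : Matrix (Fin m) (Fin m) ℝ} (hA : A.IsSymm) :
    dupMat m *ᵥ vecs A = Matrix.vec A := by
  ext ⟨j, i⟩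
  have h := congrFun (congrFun (symMat_vecs hA) j) i
  simp only [symMat, Matrix.of_apply] at h
  simp [dupMat, Matrix.mulVec, dotProduct, Matrix.vec, h, hA.apply]

theorem consTop_ovecs {m : ℕ} [NeZero m] (A : Matrix (Fin m) (Fin m) ℝ) :
    consTop (A 0 0) (ovecs A) = vecs A := by
  ext k
  by_cases h : k.1 = (0, 0)
  · simp [consTop, vecs, h]
  · simp [consTop, vecs, ovecs, h]

/-! ### Scale functionals and the local parametrization of the shape matrices -/

/-- Scale functionals on the positive definite matrices: positive, homogeneous of order one,
differentiable (as functions of the free entries of a symmetric matrix) with a nonzero partial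
derivative with respect to the top-left entry, and equal to one at the identity matrix. -/
structure IsScale {m : ℕ} [NeZero m] (S : Matrix (Fin m) (Fin m) ℝ → ℝ) : Prop where
  pos : ∀ A : Matrix (Fin m) (Fin m) ℝ, A.PosDef → 0 < S A
  homogeneous : ∀ A : Matrix (Fin m) (Fin m) ℝ, A.PosDef → ∀ c : ℝ, 0 < c → S (c • A) = c * S A
  differentiable : ∀ c : VechIdx m → ℝ, (symMat c).PosDef →
    DifferentiableAt ℝ (fun c' : VechIdx m → ℝ => S (symMat c')) c
  partial_ne_zero : ∀ c : VechIdx m → ℝ, (symMat c).PosDef →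
    fderiv ℝ (fun c' : VechIdx m → ℝ => S (symMat c')) c (Pi.single (topIdx m) 1) ≠ 0
  map_one : S 1 = 1

open Classical in
/-- The top-left entry of a shape matrix as a function of its other entries `v`, determined
implicitly by `S (V) = 1`. For a scale functional the solution is unique when it exists, since
`S` is injective along the segment of positive definite matrices with the other entries fixed;
it exists for `v` near the entries of any shape matrix. -/
def v11 {m : ℕ} [NeZero m] (S : Matrix (Fin m) (Fin m) ℝ → ℝ) (v : OffIdx m → ℝ) : ℝ :=
  if h : ∃ a : ℝ, (symMat (consTop a v)).PosDef ∧ S (symMat (consTop a v)) = 1 then h.choose else 0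

/-- The shape matrix `V_S` with free entries `v`. -/
def shapeMat {m : ℕ} [NeZero m] (S : Matrix (Fin m) (Fin m) ℝ → ℝ) (v : OffIdx m → ℝ) :
    Matrix (Fin m) (Fin m) ℝ :=
  symMat (consTop (v11 S v) v)

/-- `K_V`: the row `∇ᵀ [V]₁₁`, evaluated at the free entries of `V`, on top of an identity
matrix. -/
def KMat {m : ℕ} [NeZero m] (S : Matrix (Fin m) (Fin m) ℝ → ℝ) (V : Matrix (Fin m) (Fin m) ℝ) :
    Matrix (VechIdx m) (OffIdx m) ℝ :=
  Matrix.of fun k l =>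
    if k = topIdx m then fderiv ℝ (v11 S) (ovecs V) (Pi.single l 1)
    else if k.1 = l.1 then 1 else 0

/-- `M_S^V = K_Vᵀ D_mᵀ`. -/
def MMat {m : ℕ} [NeZero m] (S : Matrix (Fin m) (Fin m) ℝ → ℝ) (V : Matrix (Fin m) (Fin m) ℝ) :
    Matrix (OffIdx m) (Fin m × Fin m) ℝ :=
  (KMat S V)ᵀ * (dupMat m)ᵀ

/-! ### Density generators -/

/-- The value `δ_m = π^(-m/2) Γ(m/2)`. -/
def delta (m : ℕ) : ℝ := Real.pi ^ (-((m : ℝ) / 2)) * Real.Gamma ((m : ℝ) / 2)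

/-- The set `𝒢` of density generators. Only the values on `(0, ∞)` matter. The integral is
nonzero, hence the integrand is integrable. -/
def Gen (m : ℕ) : Set (ℝ → ℝ) :=
  {g | (∀ t, 0 < t → 0 ≤ g t) ∧ ∫ t in Ioi (0 : ℝ), t ^ ((m : ℝ) / 2 - 1) * g t = delta m}

/-- The set of the density generators that are constrained by `E{𝒬} = m`. -/
def GenC (m : ℕ) : Set (ℝ → ℝ) :=
  {g | g ∈ Gen m ∧ (delta m)⁻¹ * ∫ q in Ioi (0 : ℝ), q ^ ((m : ℝ) / 2) * g q = m}

/-- The law of the second-order modular variate `𝒬` for the density generator `g`; its density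
is `δ_m⁻¹ q^(m/2-1) g (q)` on `(0, ∞)`. -/
def modularLaw (m : ℕ) (g : ℝ → ℝ) : Measure ℝ :=
  (volume.restrict (Ioi (0 : ℝ))).withDensity
    fun q => ENNReal.ofReal ((delta m)⁻¹ * q ^ ((m : ℝ) / 2 - 1) * g q)

/-- `φ (t) = -2 g' (t) / g (t)`. -/
def phi (g : ℝ → ℝ) (t : ℝ) : ℝ := -2 / g t * deriv g t

/-- `α (g) = E{𝒬² φ² (𝒬)} / (m (m + 2))`. -/
def alpha (m : ℕ) (g : ℝ → ℝ) : ℝ :=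
  (∫ q, q ^ 2 * phi g q ^ 2 ∂modularLaw m g) / ((m : ℝ) * (m + 2))

/-- `β (g) = E{𝒬 φ² (𝒬)} / m`. -/
def beta (m : ℕ) (g : ℝ → ℝ) : ℝ := (∫ q, q * phi g q ^ 2 ∂modularLaw m g) / (m : ℝ)

/-! ### The two elliptical models -/

/-- The index set of `γ = (μᵀ, ovecs (V)ᵀ)ᵀ`. -/
abbrev GammaIdx (m : ℕ) [NeZero m] : Type := Fin m ⊕ OffIdx m

/-- The quadratic form `zᵀ A⁻¹ z`. -/
def quadInv {m : ℕ} (A : Matrix (Fin m) (Fin m) ℝ) (z : Fin m → ℝ) : ℝ := z ⬝ᵥ (A⁻¹ *ᵥ z)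

/-- The densities `|V|^(-1/2) g ((x - μ)ᵀ V⁻¹ (x - μ))` of the unconstrained model. -/
def pdfU {m : ℕ} [NeZero m] (S : Matrix (Fin m) (Fin m) ℝ → ℝ) (γ : GammaIdx m → ℝ) (g : ℝ → ℝ)
    (x : Fin m → ℝ) : ℝ :=
  (shapeMat S (γ ∘ Sum.inr)).det ^ (-(1 / 2) : ℝ) *
    g (quadInv (shapeMat S (γ ∘ Sum.inr)) (x - γ ∘ Sum.inl))

/-- The densities `s^(-m/2) |V|^(-1/2) g (s⁻¹ (x - μ)ᵀ V⁻¹ (x - μ))` of the constrained model. -/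
def pdfC {m : ℕ} [NeZero m] (S : Matrix (Fin m) (Fin m) ℝ → ℝ) (γ : GammaIdx m → ℝ) (s : ℝ)
    (g : ℝ → ℝ) (x : Fin m → ℝ) : ℝ :=
  s ^ (-((m : ℝ) / 2)) * (shapeMat S (γ ∘ Sum.inr)).det ^ (-(1 / 2) : ℝ) *
    g (s⁻¹ * quadInv (shapeMat S (γ ∘ Sum.inr)) (x - γ ∘ Sum.inl))

/-- The unconstrained generator `t ↦ s^(-m/2) g (s⁻¹ t)` that corresponds to the scale `s` and the
constrained generator `g`. -/
def rescale (m : ℕ) (s : ℝ) (g : ℝ → ℝ) : ℝ → ℝ := fun t => s ^ (-((m : ℝ) / 2)) * g (s⁻¹ * t)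

/-! ### Scores, tangent spaces and efficient information -/

section Geometry

variable {m : ℕ}

/-- The probability distribution with density `p` with respect to the Lebesgue measure. -/
def law (p : (Fin m → ℝ) → ℝ) : Measure (Fin m → ℝ) :=
  volume.withDensity fun x => ENNReal.ofReal (p x)

/-- Membership in the Hilbert space of square-integrable functions with zero mean. -/
def InH (P : Measure (Fin m → ℝ)) (f : (Fin m → ℝ) → ℝ) : Prop :=
  MemLp f 2 P ∧ ∫ x, f x ∂P = 0

open Classical in
/-- The element of `L²(P)` given by a function (zero if it is not square-integrable). -/
def toL2 (P : Measure (Fin m → ℝ)) (f : (Fin m → ℝ) → ℝ) : Lp ℝ 2 P :=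
  if h : MemLp f 2 P then h.toLp f else 0

/-- The score `∂ ln p (x | θ) / ∂ θ_i` at `θ₀`. -/
def score {ι : Type} [DecidableEq ι] (p : (ι → ℝ) → (Fin m → ℝ) → ℝ) (θ₀ : ι → ℝ) (i : ι)
    (x : Fin m → ℝ) : ℝ :=
  deriv (fun t => Real.log (p (Function.update θ₀ i t) x)) (θ₀ i)

/-- The tangent space of a parametric model: the span of its scores. -/
def paramTangent {ι : Type} [DecidableEq ι] (p : (ι → ℝ) → (Fin m → ℝ) → ℝ) (θ₀ : ι → ℝ) :
    Submodule ℝ (Lp ℝ 2 (law (p θ₀))) :=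
  Submodule.span ℝ (range fun i => toL2 (law (p θ₀)) (score p θ₀ i))

/-- `ρ ↦ q ρ` is a regular `r`-dimensional parametric submodel of the set `F` of densities, with
true density `p₀ = q ρ₀`: near `ρ₀` it stays in `F`, it is differentiable at `ρ₀`, and its relative
increments are dominated by a square-integrable function (the condition that allows one to
differentiate expectations of square-integrable functions under the integral sign). -/
structure IsRegularSubmodel (F : Set ((Fin m → ℝ) → ℝ)) (p₀ : (Fin m → ℝ) → ℝ) {r : ℕ}
    (q : (Fin r → ℝ) → (Fin m → ℝ) → ℝ) (ρ₀ : Fin r → ℝ) : Prop where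
  mem : ∀ᶠ ρ in 𝓝 ρ₀, q ρ ∈ F
  true_density : q ρ₀ = p₀
  differentiable : ∀ᵐ x ∂law p₀, DifferentiableAt ℝ (fun ρ => q ρ x) ρ₀
  dominated : ∃ b : (Fin m → ℝ) → ℝ, MemLp b 2 (law p₀) ∧
    ∀ᶠ ρ in 𝓝 ρ₀, ∀ᵐ x ∂law p₀, |q ρ x - p₀ x| ≤ ‖ρ - ρ₀‖ * b x * p₀ x

/-- The tangent space at `p₀` of a nonparametric set `F` of densities: the closed linear span of
the scores of all regular parametric submodels. -/
def tangent (F : Set ((Fin m → ℝ) → ℝ)) (p₀ : (Fin m → ℝ) → ℝ) :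
    Submodule ℝ (Lp ℝ 2 (law p₀)) :=
  (Submodule.span ℝ {h : Lp ℝ 2 (law p₀) |
    ∃ (r : ℕ) (q : (Fin r → ℝ) → (Fin m → ℝ) → ℝ) (ρ₀ : Fin r → ℝ) (j : Fin r),
      IsRegularSubmodel F p₀ q ρ₀ ∧ h =ᵐ[law p₀] score q ρ₀ j}).topologicalClosure

/-- The efficient score `s - Π (s | T)`. The projection is the one onto the closure of `T`, which
is `T` itself when `T` is closed. -/
def effScore {P : Measure (Fin m → ℝ)} (T : Submodule ℝ (Lp ℝ 2 P)) (s : Lp ℝ 2 P) : Lp ℝ 2 P :=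
  s - T.topologicalClosure.starProjection s

/-- The efficient Fisher information matrix `E₀{s̄ s̄ᵀ}` for the parameter with score vector `s`
and nuisance tangent space `T`. -/
def effInfo {ι : Type} {P : Measure (Fin m → ℝ)} (s : ι → (Fin m → ℝ) → ℝ)
    (T : Submodule ℝ (Lp ℝ 2 P)) : Matrix ι ι ℝ :=
  Matrix.of fun i j => ∫ x, effScore T (toL2 P (s i)) x * effScore T (toL2 P (s j)) x ∂P

end Geometry

/-! ### The three efficient information matrices -/

section Information

variable {m : ℕ} [NeZero m]

/-- The finite-dimensional parameter `γ₀ = (μ₀ᵀ, ovecs (V₀)ᵀ)ᵀ`. -/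
def gammaOf (μ : Fin m → ℝ) (V : Matrix (Fin m) (Fin m) ℝ) : GammaIdx m → ℝ :=
  Sum.elim μ (ovecs V)

/-- The score vector of `γ` at `γ₀` in the unconstrained model with generator `g₀`. -/
def scoreU (S : Matrix (Fin m) (Fin m) ℝ → ℝ) (γ₀ : GammaIdx m → ℝ) (g₀ : ℝ → ℝ) :
    GammaIdx m → (Fin m → ℝ) → ℝ :=
  score (fun γ => pdfU S γ g₀) γ₀

/-- The score vector of `γ` at `γ₀` in the constrained model with scale `s₀` and generator `g`. -/
def scoreC (S : Matrix (Fin m) (Fin m) ℝ → ℝ) (γ₀ : GammaIdx m → ℝ) (s₀ : ℝ) (g : ℝ → ℝ) :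
    GammaIdx m → (Fin m → ℝ) → ℝ :=
  score (fun γ => pdfC S γ s₀ g) γ₀

/-- The one-parameter model in which only the scale varies. -/
def scaleModel (S : Matrix (Fin m) (Fin m) ℝ → ℝ) (γ₀ : GammaIdx m → ℝ) (g : ℝ → ℝ) :
    (Unit → ℝ) → (Fin m → ℝ) → ℝ :=
  fun σ => pdfC S γ₀ (σ ()) g

/-- The score of the scale at `s₀`. -/
def scoreS (S : Matrix (Fin m) (Fin m) ℝ → ℝ) (γ₀ : GammaIdx m → ℝ) (s₀ : ℝ) (g : ℝ → ℝ) :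
    (Fin m → ℝ) → ℝ :=
  score (scaleModel S γ₀ g) (fun _ => s₀) ()

/-- The tangent space of the scale at `s₀`. -/
def tangentS (S : Matrix (Fin m) (Fin m) ℝ → ℝ) (γ₀ : GammaIdx m → ℝ) (s₀ : ℝ) (g : ℝ → ℝ) :
    Submodule ℝ (Lp ℝ 2 (law (pdfC S γ₀ s₀ g))) :=
  paramTangent (scaleModel S γ₀ g) (fun _ => s₀)

/-- The tangent space of the unconstrained nonparametric model at `g₀`. -/
def tangentU (S : Matrix (Fin m) (Fin m) ℝ → ℝ) (γ₀ : GammaIdx m → ℝ) (g₀ : ℝ → ℝ) :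
    Submodule ℝ (Lp ℝ 2 (law (pdfU S γ₀ g₀))) :=
  tangent (pdfU S γ₀ '' Gen m) (pdfU S γ₀ g₀)

/-- The tangent space of the constrained nonparametric model at `g`. -/
def tangentC (S : Matrix (Fin m) (Fin m) ℝ → ℝ) (γ₀ : GammaIdx m → ℝ) (s₀ : ℝ) (g : ℝ → ℝ) :
    Submodule ℝ (Lp ℝ 2 (law (pdfC S γ₀ s₀ g))) :=
  tangent (pdfC S γ₀ s₀ '' GenC m) (pdfC S γ₀ s₀ g)

/-- The efficient semiparametric information for `γ₀` in the unconstrained model. -/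
def infoU (S : Matrix (Fin m) (Fin m) ℝ → ℝ) (γ₀ : GammaIdx m → ℝ) (g₀ : ℝ → ℝ) :
    Matrix (GammaIdx m) (GammaIdx m) ℝ :=
  effInfo (scoreU S γ₀ g₀) (tangentU S γ₀ g₀)

/-- The efficient semiparametric information for `γ₀` in the constrained model, with both the
scale and the constrained generator as nuisance. -/
def infoC (S : Matrix (Fin m) (Fin m) ℝ → ℝ) (γ₀ : GammaIdx m → ℝ) (s₀ : ℝ) (g : ℝ → ℝ) :
    Matrix (GammaIdx m) (GammaIdx m) ℝ :=
  effInfo (scoreC S γ₀ s₀ g) (tangentS S γ₀ s₀ g ⊔ tangentC S γ₀ s₀ g)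

/-- The efficient parametric information for `γ₀` with the scale as the only nuisance. -/
def infoS (S : Matrix (Fin m) (Fin m) ℝ → ℝ) (γ₀ : GammaIdx m → ℝ) (s₀ : ℝ) (g : ℝ → ℝ) :
    Matrix (GammaIdx m) (GammaIdx m) ℝ :=
  effInfo (scoreC S γ₀ s₀ g) (tangentS S γ₀ s₀ g)

/-- `I_μ = β (g) (s V)⁻¹`. -/
def infoMu (s : ℝ) (V : Matrix (Fin m) (Fin m) ℝ) (g : ℝ → ℝ) : Matrix (Fin m) (Fin m) ℝ :=
  beta m g • (s • V)⁻¹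

/-- `2⁻¹ α (g) M [(V⁻¹ ⊗ V⁻¹) - m⁻¹ vec (V⁻¹) vec (V⁻¹)ᵀ] Mᵀ` with `M = M_S^V`. -/
def infoShape (S : Matrix (Fin m) (Fin m) ℝ → ℝ) (V : Matrix (Fin m) (Fin m) ℝ) (g : ℝ → ℝ) :
    Matrix (OffIdx m) (OffIdx m) ℝ :=
  (2⁻¹ * alpha m g) •
    (MMat S V *
      (V⁻¹ ⊗ₖ V⁻¹ - (m : ℝ)⁻¹ • Matrix.vecMulVec (Matrix.vec V⁻¹) (Matrix.vec V⁻¹)) *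
      (MMat S V)ᵀ)

end Information

end Elliptical

end

open Elliptical

/-!
All scores are computed in standardized coordinates. With `A Aᵀ = s V` and `x = μ + A y`, the true
distribution becomes the spherical distribution with density `g (‖y‖²)`, the law of `𝒬 = ‖y‖²` is
the modular law (`measurePreserving_normSq`, `IsTrueParam.measurePreserving`), and the score of the
scale is `(2 s)⁻¹ (𝒬 φ(𝒬) - m)`. The score of `μ` is `φ(𝒬) A⁻ᵀ y`, and the score of a free entry of
`V` is `½ (φ(𝒬) yᵀ B y - tr B)`, where `B` is the derivative of `s V` in the new coordinates. Writing
`B` as its traceless part plus a multiple of the identity matrix splits the latter into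
`½ φ(𝒬) yᵀ B₀ y` and a multiple of the score of the scale (`IsTrueParam.residual_affine_ae`).

The first terms, the residuals, are orthogonal to every square-integrable function of `‖y‖²`
(`integral_stdEff_mul_radial`). All three nuisance tangent spaces consist of such functions, since
the densities of the nuisance submodels depend on the data through `‖y‖²` only
(`IsTrueParam.tangent_le`, `IsTrueParam.tangentS_le`). Moreover all three contain the score of the
scale: this is trivial for the two models with a scale, and for the unconstrained model it holds
because `1 + ρ f` is an admissible perturbation of the generator for each bounded centred `f`, and
such `f` are dense among the centred square-integrable functions (`IsTrueParam.scoreS_mem_tangent`).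
Hence the residual is the efficient score in each case, and the three information matrices are equal
to its covariance matrix (`IsTrueParam.effInfo_eq`).

The covariance matrix follows from the moments of order two and four of a spherical vector with a
radial weight (`Spherical.integral_mul_mul`, `Spherical.integral_quartic`). These are derived from
the invariance under sign changes and under one reflection that mixes two coordinates, an argument
that needs no measurability of the radial weight; this matters because the scores of submodels are
only pointwise derivatives. That the scores are centred is the identity `E{𝒬 φ(𝒬)} = m`, an
integration by parts (`integral_mul_phi`). The local parametrization `v ↦ V₁₁` is differentiable by
an implicit function argument that uses only pointwise differentiability of the scale functional
(`eventually_v11`, `differentiableAt_v11`).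
-/

noncomputable section

namespace Elliptical

/-! ### Radial change of variables -/

theorem map_withDensity_comp {α β : Type*} [MeasurableSpace α] [MeasurableSpace β]
    {μ : Measure α} {f : α → β} (hf : Measurable f) {u : β → ENNReal}
    (hu : AEMeasurable u (μ.map f)) :
    (μ.withDensity (u ∘ f)).map f = (μ.map f).withDensity u := by
  ext s hs
  rw [Measure.map_apply hf hs, withDensity_apply _ (hf hs), withDensity_apply _ hs,
    ← lintegral_indicator hs, ← lintegral_indicator (hf hs),
    lintegral_map' (hu.indicator hs) hf.aemeasurable]
  rfl

/-- The squared Euclidean norm. -/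
def normSq {m : ℕ} (y : Fin m → ℝ) : ℝ := y ⬝ᵥ y

theorem normSq_eq_sum {m : ℕ} (y : Fin m → ℝ) : normSq y = ∑ a, y a ^ 2 := by
  simp [normSq, dotProduct, sq]

theorem continuous_normSq {m : ℕ} : Continuous (normSq : (Fin m → ℝ) → ℝ) := by
  unfold normSq; fun_prop

theorem measurable_normSq {m : ℕ} : Measurable (normSq : (Fin m → ℝ) → ℝ) :=
  continuous_normSq.measurable

theorem normSq_nonneg {m : ℕ} (y : Fin m → ℝ) : 0 ≤ normSq y := by
  rw [normSq_eq_sum]; positivity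

theorem sq_le_normSq {m : ℕ} (y : Fin m → ℝ) (a : Fin m) : y a ^ 2 ≤ normSq y := by
  rw [normSq_eq_sum]
  exact Finset.single_le_sum (f := fun a => y a ^ 2) (fun i _ => sq_nonneg _) (Finset.mem_univ a)

theorem delta_pos (m : ℕ) [NeZero m] : 0 < delta m := by
  have : (0 : ℝ) < m := Nat.cast_pos.2 (NeZero.pos m)
  unfold delta
  have := Real.Gamma_pos_of_pos (half_pos this)
  positivity

theorem volume_normSq_lt {m : ℕ} [NeZero m] {t : ℝ} (ht : 0 < t) :
    volume {y : Fin m → ℝ | normSq y < t} =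
      ENNReal.ofReal ((delta m)⁻¹ * (t ^ ((m : ℝ) / 2) / ((m : ℝ) / 2))) := by
  have hm : (0 : ℝ) < m := Nat.cast_pos.2 (NeZero.pos m)
  have hpre : {y : Fin m → ℝ | normSq y < t} =
      (MeasurableEquiv.toLp 2 (Fin m → ℝ)) ⁻¹' Metric.ball (0 : EuclideanSpace ℝ (Fin m)) √t := by
    ext y
    simp [normSq_eq_sum, EuclideanSpace.norm_eq, Real.sqrt_lt_sqrt_iff_of_pos ht]
  have hvol := (EuclideanSpace.volume_preserving_symm_measurableEquiv_toLp
    (Fin m)).symm.measure_preimage (measurableSet_ball (x := (0 : EuclideanSpace ℝ (Fin m)))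
      (ε := √t)).nullMeasurableSet
  rw [MeasurableEquiv.symm_symm] at hvol
  rw [hpre, hvol, EuclideanSpace.volume_ball,
    ← ENNReal.ofReal_pow (Real.sqrt_nonneg _), ← ENNReal.ofReal_mul (by positivity)]
  congr 1
  have h1 : √t ^ m = t ^ ((m : ℝ) / 2) := by
    rw [Real.sqrt_eq_rpow, ← Real.rpow_natCast, ← Real.rpow_mul ht.le]; congr 1; ring
  have h2 : √Real.pi ^ m = Real.pi ^ ((m : ℝ) / 2) := by
    rw [Real.sqrt_eq_rpow, ← Real.rpow_natCast, ← Real.rpow_mul Real.pi_pos.le]; congr 1; ring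
  have hG := Real.Gamma_pos_of_pos (half_pos hm)
  rw [Fintype.card_fin, h1, h2, delta, Real.Gamma_add_one (by positivity),
    Real.rpow_neg Real.pi_pos.le]
  field_simp

/-- Lebesgue measure in polar coordinates: the image of the Lebesgue measure under the squared norm
has density `δ_m⁻¹ t^(m/2-1)` on `(0, ∞)`. -/
theorem map_normSq_volume (m : ℕ) [NeZero m] :
    (volume : Measure (Fin m → ℝ)).map normSq =
      (volume.restrict (Ioi (0 : ℝ))).withDensity
        fun t => ENNReal.ofReal ((delta m)⁻¹ * t ^ ((m : ℝ) / 2 - 1)) := by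
  have hm : (0 : ℝ) < m := Nat.cast_pos.2 (NeZero.pos m)
  have hL : ∀ t : ℝ, (volume : Measure (Fin m → ℝ)).map normSq (Iio t) =
      ENNReal.ofReal (if 0 < t then (delta m)⁻¹ * (t ^ ((m : ℝ) / 2) / ((m : ℝ) / 2)) else 0) := by
    intro t
    rw [Measure.map_apply measurable_normSq measurableSet_Iio]
    split_ifs with ht
    · exact volume_normSq_lt ht
    · have : normSq ⁻¹' Iio t = (∅ : Set (Fin m → ℝ)) := by
        ext y
        have := normSq_nonneg y
        simp only [mem_preimage, mem_Iio, mem_empty_iff_false, iff_false]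
        linarith
      simp [this]
  refine Measure.FiniteSpanningSetsIn.ext (C := range Iio)
    (BorelSpace.measurable_eq.trans (borel_eq_generateFrom_Iio ℝ)) isPiSystem_Iio
    ⟨fun n => Iio (n : ℝ), fun n => ⟨_, rfl⟩, fun n => ?_, ?_⟩ ?_
  · rw [hL]; exact ENNReal.ofReal_lt_top
  · exact iUnion_eq_univ_iff.2 fun x => exists_nat_gt x
  · rintro _ ⟨t, rfl⟩
    rw [hL, withDensity_apply _ measurableSet_Iio, Measure.restrict_restrict measurableSet_Iio]
    split_ifs with ht
    · have hint : IntervalIntegrable (fun u : ℝ => (delta m)⁻¹ * u ^ ((m : ℝ) / 2 - 1)) volume 0 t :=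
        (intervalIntegral.intervalIntegrable_rpow' (by linarith)).const_mul _
      have hset : Iio t ∩ Ioi 0 = Ioo 0 t := by ext; simp [and_comm]
      rw [hset, restrict_Ioo_eq_restrict_Ioc, ← ofReal_integral_eq_lintegral_ofReal hint.1,
        ← intervalIntegral.integral_of_le ht.le, intervalIntegral.integral_const_mul,
        integral_rpow (Or.inl (by linarith))]
      · simp [hm.ne']
      · filter_upwards [ae_restrict_mem measurableSet_Ioc] with u hu
        have := delta_pos m
        have := hu.1
        simp only [Pi.zero_apply]
        positivity
    · have hset : Iio t ∩ Ioi 0 = ∅ := by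
        ext x; simp only [mem_inter_iff, mem_Iio, mem_Ioi, mem_empty_iff_false, iff_false]
        rintro ⟨h1, h2⟩; exact ht (h2.trans h1)
      simp [hset]

theorem aemeasurable_ofReal_of_continuousOn {m : ℕ} [NeZero m] {g : ℝ → ℝ}
    (hg : ContinuousOn g (Ioi 0)) :
    AEMeasurable (fun t => ENNReal.ofReal (g t)) ((volume : Measure (Fin m → ℝ)).map normSq) := by
  rw [map_normSq_volume]
  exact ((hg.aemeasurable measurableSet_Ioi).ennreal_ofReal).mono_ac
    (withDensity_absolutelyContinuous _ _)

/-- The spherical distribution with density `g (‖y‖²)`. -/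
def sphLaw (m : ℕ) (g : ℝ → ℝ) : Measure (Fin m → ℝ) :=
  volume.withDensity fun y => ENNReal.ofReal (g (normSq y))

theorem modularLaw_eq {m : ℕ} [NeZero m] {g : ℝ → ℝ} (hg : ContinuousOn g (Ioi 0)) :
    modularLaw m g =
      ((volume : Measure (Fin m → ℝ)).map normSq).withDensity fun t => ENNReal.ofReal (g t) := by
  have h1 : Measurable fun t : ℝ => ENNReal.ofReal ((delta m)⁻¹ * t ^ ((m : ℝ) / 2 - 1)) := by
    fun_prop
  rw [map_normSq_volume, ← withDensity_mul₀ h1.aemeasurable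
    (hg.aemeasurable measurableSet_Ioi).ennreal_ofReal, modularLaw]
  refine withDensity_congr_ae ?_
  filter_upwards [ae_restrict_mem measurableSet_Ioi] with t ht
  have := delta_pos m
  have ht' : 0 < t := ht
  rw [Pi.mul_apply, ← ENNReal.ofReal_mul (by positivity)]

/-- The squared norm of a spherical vector has the modular law. -/
theorem measurePreserving_normSq {m : ℕ} [NeZero m] {g : ℝ → ℝ} (hg : ContinuousOn g (Ioi 0)) :
    MeasurePreserving normSq (sphLaw m g) (modularLaw m g) := by
  refine ⟨measurable_normSq, ?_⟩
  rw [modularLaw_eq hg, ← map_withDensity_comp measurable_normSq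
    (aemeasurable_ofReal_of_continuousOn hg)]
  rfl

theorem modularLaw_ac (m : ℕ) (g : ℝ → ℝ) : modularLaw m g ≪ volume.restrict (Ioi (0 : ℝ)) :=
  withDensity_absolutelyContinuous _ _

/-! ### Spherical symmetry and moments -/

/-- Invariance under the orthogonal involutions. These suffice for the moments up to order four. -/
def Spherical {m : ℕ} (ν : Measure (Fin m → ℝ)) : Prop :=
  ∀ f : (Fin m → ℝ) →ₗ[ℝ] (Fin m → ℝ), (∀ y, f (f y) = y) → (∀ y, normSq (f y) = normSq y) →
    MeasurePreserving f ν ν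

theorem map_volume_of_involutive {m : ℕ} (f : (Fin m → ℝ) →ₗ[ℝ] (Fin m → ℝ))
    (hf : ∀ y, f (f y) = y) : (volume : Measure (Fin m → ℝ)).map f = volume := by
  have h1 : LinearMap.det f * LinearMap.det f = 1 := by
    rw [← map_mul, ← LinearMap.det_id (M := Fin m → ℝ)]
    congr 1
    ext1 y
    ext
    simp [hf]
  have h2 : |LinearMap.det f| = 1 := by
    rw [← abs_one, ← sq_eq_sq_iff_abs_eq_abs, sq, h1, one_pow]
  rw [Real.map_linearMap_volume_pi_eq_smul_volume_pi (left_ne_zero_of_mul_eq_one h1), abs_inv, h2]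
  simp

theorem spherical_sphLaw {m : ℕ} [NeZero m] {g : ℝ → ℝ} (hg : ContinuousOn g (Ioi 0)) :
    Spherical (sphLaw m g) := by
  intro f hf hn
  have hm : Measurable f := f.continuous_of_finiteDimensional.measurable
  refine ⟨hm, ?_⟩
  have h := map_withDensity_comp (μ := (volume : Measure (Fin m → ℝ))) hm
    (u := fun y => ENNReal.ofReal (g (normSq y))) (by
      rw [map_volume_of_involutive f hf]
      exact (aemeasurable_ofReal_of_continuousOn hg).comp_measurable measurable_normSq)
  rw [map_volume_of_involutive f hf] at h
  have h2 : (fun y => ENNReal.ofReal (g (normSq y))) ∘ f =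
      fun y => ENNReal.ofReal (g (normSq y)) := by
    ext y; simp [hn]
  rw [h2] at h
  exact h

/-- Functions that depend on the squared norm only. No measurability is included. -/
def Radial {m : ℕ} (W : (Fin m → ℝ) → ℝ) : Prop :=
  ∀ y y', normSq y = normSq y' → W y = W y'

section Moments

variable {m : ℕ} {ν : Measure (Fin m → ℝ)} {W : (Fin m → ℝ) → ℝ}

theorem Spherical.integral_comp (hν : Spherical ν) (f : (Fin m → ℝ) →ₗ[ℝ] (Fin m → ℝ))
    (hf : ∀ y, f (f y) = y) (hn : ∀ y, normSq (f y) = normSq y) (F : (Fin m → ℝ) → ℝ) :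
    ∫ y, F (f y) ∂ν = ∫ y, F y ∂ν :=
  (hν f hf hn).integral_comp
    (MeasurableEquiv.ofInvolutive f hf
      f.continuous_of_finiteDimensional.measurable).measurableEmbedding F

/-- The change of sign of the coordinate `a`. -/
def flip (a : Fin m) : (Fin m → ℝ) →ₗ[ℝ] (Fin m → ℝ) where
  toFun y i := if i = a then -y i else y i
  map_add' x y := by ext i; dsimp only [Pi.add_apply]; split_ifs <;> ring
  map_smul' c y := by
    ext i
    dsimp only [Pi.smul_apply, smul_eq_mul, RingHom.id_apply]
    split_ifs <;> ring

/-- The reflection of the plane of the coordinates `a`, `b` that sends the `a`-axis to the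
diagonal. -/
def mix (a b : Fin m) : (Fin m → ℝ) →ₗ[ℝ] (Fin m → ℝ) where
  toFun y i := if i = a then (y a + y b) / √2 else if i = b then (y a - y b) / √2 else y i
  map_add' x y := by ext i; dsimp only [Pi.add_apply]; split_ifs <;> ring
  map_smul' c y := by
    ext i
    dsimp only [Pi.smul_apply, smul_eq_mul, RingHom.id_apply]
    split_ifs <;> ring

theorem flip_apply (a i : Fin m) (y : Fin m → ℝ) : flip a y i = if i = a then -y i else y i := rfl

theorem flip_flip (a : Fin m) (y : Fin m → ℝ) : flip a (flip a y) = y := by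
  ext i; simp only [flip_apply]; split_ifs <;> simp

theorem normSq_flip (a : Fin m) (y : Fin m → ℝ) : normSq (flip a y) = normSq y := by
  simp only [normSq_eq_sum, flip_apply]
  refine Finset.sum_congr rfl fun i _ => ?_
  split_ifs <;> ring

theorem mix_left (a b : Fin m) (y : Fin m → ℝ) : mix a b y a = (y a + y b) / √2 := by
  simp [mix]

theorem mix_right {a b : Fin m} (h : a ≠ b) (y : Fin m → ℝ) : mix a b y b = (y a - y b) / √2 := by
  simp [mix, h.symm]

theorem mix_of_ne {a b i : Fin m} (ha : i ≠ a) (hb : i ≠ b) (y : Fin m → ℝ) :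
    mix a b y i = y i := by
  simp [mix, ha, hb]

theorem mix_mix {a b : Fin m} (h : a ≠ b) (y : Fin m → ℝ) : mix a b (mix a b y) = y := by
  have h2 : √(2 : ℝ) * √2 = 2 := Real.mul_self_sqrt (by norm_num)
  ext i
  by_cases ha : i = a
  · subst ha
    rw [mix_left, mix_left, mix_right h, ← add_div, div_div, h2]
    ring
  by_cases hb : i = b
  · subst hb
    rw [mix_right h, mix_left, mix_right h, ← sub_div, div_div, h2]
    ring
  rw [mix_of_ne ha hb, mix_of_ne ha hb]

theorem normSq_mix {a b : Fin m} (h : a ≠ b) (y : Fin m → ℝ) : normSq (mix a b y) = normSq y := by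
  have h2 : √(2 : ℝ) ^ 2 = 2 := Real.sq_sqrt (by norm_num)
  have key : ∀ z : Fin m → ℝ, normSq z = z a ^ 2 + z b ^ 2 +
      ∑ i ∈ (Finset.univ.erase a).erase b, z i ^ 2 := by
    intro z
    rw [normSq_eq_sum, ← Finset.add_sum_erase _ _ (Finset.mem_univ a),
      ← Finset.add_sum_erase (Finset.univ.erase a) _
        (Finset.mem_erase.2 ⟨h.symm, Finset.mem_univ b⟩), add_assoc]
  rw [key, key y, mix_left, mix_right h]
  congr 1
  · rw [div_pow, div_pow, h2]; ring
  · refine Finset.sum_congr rfl fun i hi => ?_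
    simp only [Finset.mem_erase] at hi
    rw [mix_of_ne hi.2.1 hi.1]

/-- Integrals that change sign under the flip of one coordinate vanish, whether or not the
integrand is integrable. -/
theorem Spherical.integral_eq_zero_of_flip (hν : Spherical ν) (a : Fin m)
    {F : (Fin m → ℝ) → ℝ} (hF : ∀ y, F (flip a y) = -F y) : ∫ y, F y ∂ν = 0 := by
  have h := hν.integral_comp (flip a) (flip_flip a) (normSq_flip a) F
  simp only [hF, integral_neg] at h
  linarith

theorem Spherical.integral_odd (hν : Spherical ν) {F : (Fin m → ℝ) → ℝ}
    (hF : ∀ y, F (-y) = -F y) : ∫ y, F y ∂ν = 0 := by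
  have h := hν.integral_comp (-LinearMap.id) (fun y => by simp) (fun y => by simp [normSq]) F
  simp only [LinearMap.neg_apply, LinearMap.id_apply, hF, integral_neg] at h
  linarith

theorem Spherical.integral_mul_mul_of_ne (hν : Spherical ν) (hW : Radial W) {a b : Fin m}
    (h : a ≠ b) : ∫ y, W y * (y a * y b) ∂ν = 0 := by
  refine hν.integral_eq_zero_of_flip a fun y => ?_
  rw [hW _ _ (normSq_flip a y)]
  simp [flip_apply, h.symm]

/-- Second moments with a radial weight. -/
theorem Spherical.integral_mul_mul (hν : Spherical ν) (hW : Radial W)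
    (hi : ∀ a b, Integrable (fun y => W y * (y a * y b)) ν) (a b : Fin m) :
    ∫ y, W y * (y a * y b) ∂ν = if a = b then (∫ y, W y * normSq y ∂ν) / m else 0 := by
  split_ifs with hab
  swap
  · exact hν.integral_mul_mul_of_ne hW hab
  subst hab
  have heq : ∀ b, ∫ y, W y * (y b * y b) ∂ν = ∫ y, W y * (y a * y a) ∂ν := by
    intro b
    by_cases hb : a = b
    · rw [hb]
    have h2 : √(2 : ℝ) * √2 = 2 := Real.mul_self_sqrt (by norm_num)
    have h := hν.integral_comp (mix a b) (mix_mix hb) (normSq_mix hb)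
      fun y => W y * (y a * y b)
    rw [hν.integral_mul_mul_of_ne hW hb] at h
    have h3 : ∀ y : Fin m → ℝ, W (mix a b y) * (mix a b y a * mix a b y b) =
        (1 / 2) * (W y * (y a * y a)) - (1 / 2) * (W y * (y b * y b)) := by
      intro y
      rw [hW _ _ (normSq_mix hb y), mix_left, mix_right hb, div_mul_div_comm, h2]
      ring
    simp only [h3] at h
    rw [integral_sub ((hi a a).const_mul _) ((hi b b).const_mul _), integral_const_mul,
      integral_const_mul] at h
    linarith
  have hsum : ∫ y, W y * normSq y ∂ν = m * ∫ y, W y * (y a * y a) ∂ν := by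
    have h1 : ∀ y : Fin m → ℝ, W y * normSq y = ∑ b, W y * (y b * y b) := fun y => by
      rw [normSq_eq_sum, Finset.mul_sum]; simp only [sq]
    simp only [h1]
    rw [integral_finsetSum _ fun b _ => hi b b, Finset.sum_congr rfl fun b _ => heq b]
    simp
  have hm : (m : ℝ) ≠ 0 := Nat.cast_ne_zero.2 (Nat.ne_of_gt (Fin.pos a))
  rw [hsum]
  field_simp

/-- Fourth moments with a radial weight. -/
theorem Spherical.integral_quartic (hν : Spherical ν) (hW : Radial W)
    (hi : ∀ a b c d, Integrable (fun y => W y * (y a * y b * (y c * y d))) ν) (a b c d : Fin m) :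
    ∫ y, W y * (y a * y b * (y c * y d)) ∂ν =
      ((if a = b ∧ c = d then 1 else 0) + (if a = c ∧ b = d then 1 else 0) +
        (if a = d ∧ b = c then 1 else 0)) *
      ((∫ y, W y * normSq y ^ 2 ∂ν) / ((m : ℝ) * (m + 2))) := by
  have hm0 : 0 < m := Fin.pos a
  have hm : (0 : ℝ) < m := Nat.cast_pos.2 hm0
  set M : Fin m → Fin m → Fin m → Fin m → ℝ :=
    fun a b c d => ∫ y, W y * (y a * y b * (y c * y d)) ∂ν with hM
  -- A coordinate that occurs an odd number of times makes the moment vanish.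
  have hodd1 : ∀ a b c d : Fin m, b ≠ a → c ≠ a → d ≠ a → M a b c d = 0 := by
    intro a b c d hb hc hd
    refine hν.integral_eq_zero_of_flip a fun y => ?_
    rw [hW _ _ (normSq_flip a y)]
    simp [flip_apply, hb, hc, hd]
  have hodd3 : ∀ a b : Fin m, a ≠ b → M a a a b = 0 := by
    intro a b hab
    refine hν.integral_eq_zero_of_flip b fun y => ?_
    rw [hW _ _ (normSq_flip b y)]
    simp [flip_apply, hab]
  have h2 : √(2 : ℝ) * √2 = 2 := Real.mul_self_sqrt (by norm_num)
  have hperm12 : ∀ a b c d, M a b c d = M b a c d := fun a b c d =>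
    integral_congr_ae (.of_forall fun y => by ring)
  have hperm23 : ∀ a b c d, M a b c d = M a c b d := fun a b c d =>
    integral_congr_ae (.of_forall fun y => by ring)
  have hperm34 : ∀ a b c d, M a b c d = M a b d c := fun a b c d =>
    integral_congr_ae (.of_forall fun y => by ring)
  have hrel1 : ∀ a b, a ≠ b → M a a a a + M b b b b = 6 * M a a b b := by
    intro a b hab
    have h := hν.integral_comp (mix a b) (mix_mix hab) (normSq_mix hab)
      fun y => W y * (y a * y b * (y a * y b))
    have h3 : ∀ y : Fin m → ℝ, W (mix a b y) *
        (mix a b y a * mix a b y b * (mix a b y a * mix a b y b)) =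
        (1 / 4) * (W y * (y a * y a * (y a * y a))) - (1 / 2) * (W y * (y a * y a * (y b * y b)))
          + (1 / 4) * (W y * (y b * y b * (y b * y b))) := by
      intro y
      rw [hW _ _ (normSq_mix hab y), mix_left, mix_right hab, div_mul_div_comm, h2]
      ring
    simp only [h3] at h
    have hsub : Integrable (fun y => (1 / 4) * (W y * (y a * y a * (y a * y a))) -
        (1 / 2) * (W y * (y a * y a * (y b * y b)))) ν :=
      ((hi a a a a).const_mul _).sub ((hi a a b b).const_mul _)
    rw [integral_add hsub ((hi b b b b).const_mul _),
      integral_sub ((hi a a a a).const_mul _) ((hi a a b b).const_mul _), integral_const_mul,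
      integral_const_mul, integral_const_mul] at h
    have h4 : M a b a b = M a a b b := hperm23 _ _ _ _
    simp only [hM] at h4 ⊢
    linarith
  have hrel2 : ∀ a b, a ≠ b → M a a a a = M b b b b := by
    intro a b hab
    have h := hν.integral_comp (mix a b) (mix_mix hab) (normSq_mix hab)
      fun y => W y * (y a * y b * (y a * y a)) + W y * (y a * y b * (y b * y b))
    have h3 : ∀ y : Fin m → ℝ, W (mix a b y) *
          (mix a b y a * mix a b y b * (mix a b y a * mix a b y a)) +
        W (mix a b y) * (mix a b y a * mix a b y b * (mix a b y b * mix a b y b)) =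
        (1 / 2) * (W y * (y a * y a * (y a * y a))) - (1 / 2) * (W y * (y b * y b * (y b * y b))) := by
      intro y
      rw [hW _ _ (normSq_mix hab y), mix_left, mix_right hab]
      simp only [div_mul_div_comm, h2]
      ring
    simp only [h3] at h
    rw [integral_sub ((hi a a a a).const_mul _) ((hi b b b b).const_mul _), integral_const_mul,
      integral_const_mul, integral_add (hi _ _ _ _) (hi _ _ _ _)] at h
    have e1 : M a b a a = 0 := by rw [hperm12, hodd1 b a a a hab hab hab]
    have e2 : M a b b b = 0 := hodd1 a b b b hab.symm hab.symm hab.symm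
    simp only [hM] at e1 e2 ⊢
    linarith
  have hkap : ∀ b c, M b b c c = (if b = c then 3 else 1) * (M a a a a / 3) := by
    have h4 : ∀ b, M b b b b = M a a a a := fun b => by
      by_cases h : a = b
      · rw [h]
      · exact (hrel2 a b h).symm
    intro b c
    split_ifs with h
    · rw [← h, h4]; ring
    · have := hrel1 b c h
      rw [h4 b, h4 c] at this
      linarith
  have hsum : ∫ y, W y * normSq y ^ 2 ∂ν = m * (m + 2) * (M a a a a / 3) := by
    have h1 : ∀ y : Fin m → ℝ, W y * normSq y ^ 2 =
        ∑ b, ∑ c, W y * (y b * y b * (y c * y c)) := fun y => by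
      rw [normSq_eq_sum, sq, Finset.sum_mul_sum, Finset.mul_sum]
      simp only [sq, Finset.mul_sum]
    simp only [h1]
    rw [integral_finsetSum _ fun b _ => integrable_finsetSum _ fun c _ => hi b b c c]
    have h5 : ∀ b, ∫ y, ∑ c, W y * (y b * y b * (y c * y c)) ∂ν =
        (m + 2) * (M a a a a / 3) := fun b => by
      rw [integral_finsetSum _ fun c _ => hi b b c c]
      rw [Finset.sum_congr rfl fun c _ => hkap b c, ← Finset.sum_mul]
      congr 1
      have : ∀ c, (if b = c then (3 : ℝ) else 1) = 1 + if b = c then 2 else 0 := fun c => by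
        split_ifs <;> norm_num
      simp [this, Finset.sum_add_distrib]
    rw [Finset.sum_congr rfl fun b _ => h5 b]
    simp
    ring
  have htau : (∫ y, W y * normSq y ^ 2 ∂ν) / ((m : ℝ) * (m + 2)) = M a a a a / 3 := by
    rw [hsum]; field_simp
  rw [htau]
  change M a b c d = _
  generalize hτ : M a a a a / 3 = τ at *
  have hz : ∀ p q r : Fin m, p ≠ q → q ≠ r → p ≠ r → ∀ s, M p q r s = 0 := by
    intro p q r hpq hqr hpr s
    by_cases hs : s = p
    · rw [hperm12]; exact hodd1 q p r s hpq hqr.symm (by rw [hs]; exact hpq)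
    · exact hodd1 p q r s hpq.symm hpr.symm hs
  by_cases hab : a = b
  · subst hab
    by_cases hcd : c = d
    · subst hcd
      rw [hkap]
      by_cases hac : a = c <;> simp [hac]
      norm_num
    · have h0 : M a a c d = 0 := by
        by_cases hac : a = c
        · subst hac; exact hodd3 a d hcd
        · rw [hperm23, hperm12]
          by_cases had : a = d
          · subst had; exact hodd1 c a a a hac hac hac
          · exact hodd1 c a a d hac hac (Ne.symm hcd)
      rw [h0]
      by_cases hac : a = c
      · have : a ≠ d := fun h => hcd (hac.symm.trans h)
        simp [hcd, this]
      · simp [hcd, hac]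
  · by_cases hac : a = c
    · subst hac
      by_cases hbd : b = d
      · subst hbd
        rw [hperm23, hkap]; simp [hab, Ne.symm hab]
      · have h0 : M a b a d = 0 := by
          rw [hperm12]
          exact hodd1 b a a d hab hab (Ne.symm hbd)
        rw [h0]; simp [hab, hbd, Ne.symm hab]
    · by_cases had : a = d
      · subst had
        by_cases hbc : b = c
        · subst hbc
          rw [hperm34, hperm23, hkap]; simp [hab]
        · have h0 : M a b c a = 0 := hz a b c hab hbc hac a
          rw [h0]; simp [hab, hbc, hac]
      · have h0 : M a b c d = 0 := hodd1 a b c d (Ne.symm hab) (Ne.symm hac) (Ne.symm had)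
        rw [h0]; simp [hab, hac, had]

end Moments

/-! ### The modular variate -/

section Modular

variable {m : ℕ} {g : ℝ → ℝ}

theorem density_nonneg [NeZero m] (hg : g ∈ Gen m) {q : ℝ} (hq : 0 < q) :
    0 ≤ (delta m)⁻¹ * q ^ ((m : ℝ) / 2 - 1) * g q := by
  have := delta_pos m
  have := hg.1 q hq
  positivity

theorem aemeasurable_density (hc : ContinuousOn g (Ioi 0)) :
    AEMeasurable (fun q => ((delta m)⁻¹ * q ^ ((m : ℝ) / 2 - 1) * g q).toNNReal)
      (volume.restrict (Ioi (0 : ℝ))) := by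
  have h1 : Measurable fun q : ℝ => (delta m)⁻¹ * q ^ ((m : ℝ) / 2 - 1) := by fun_prop
  exact (h1.aemeasurable.mul (hc.aemeasurable measurableSet_Ioi)).real_toNNReal

theorem integral_modularLaw [NeZero m] (hg : g ∈ Gen m) (hc : ContinuousOn g (Ioi 0)) (f : ℝ → ℝ) :
    ∫ q, f q ∂modularLaw m g =
      ∫ q in Ioi (0 : ℝ), (delta m)⁻¹ * q ^ ((m : ℝ) / 2 - 1) * g q * f q := by
  refine (integral_withDensity_eq_integral_smul₀ (aemeasurable_density hc) f).trans ?_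
  refine setIntegral_congr_fun measurableSet_Ioi fun q hq => ?_
  simp only [NNReal.smul_def, smul_eq_mul, Real.coe_toNNReal _ (density_nonneg hg hq)]

theorem integrable_modularLaw_iff [NeZero m] (hg : g ∈ Gen m) (hc : ContinuousOn g (Ioi 0))
    (f : ℝ → ℝ) :
    Integrable f (modularLaw m g) ↔
      IntegrableOn (fun q => (delta m)⁻¹ * q ^ ((m : ℝ) / 2 - 1) * g q * f q) (Ioi (0 : ℝ)) := by
  refine (integrable_withDensity_iff_integrable_smul₀ (aemeasurable_density hc)).trans ?_
  refine integrableOn_congr_fun (fun q hq => ?_) measurableSet_Ioi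
  simp only [NNReal.smul_def, smul_eq_mul, Real.coe_toNNReal _ (density_nonneg hg hq)]

theorem integrableOn_of_mem_gen [NeZero m] (hg : g ∈ Gen m) :
    IntegrableOn (fun t => t ^ ((m : ℝ) / 2 - 1) * g t) (Ioi (0 : ℝ)) := by
  by_contra h
  have h1 := hg.2
  rw [integral_undef h] at h1
  exact (delta_pos m).ne h1

theorem isProbabilityMeasure_modularLaw [NeZero m] (hg : g ∈ Gen m) :
    IsProbabilityMeasure (modularLaw m g) := by
  constructor
  have hi := (integrableOn_of_mem_gen hg).const_mul (delta m)⁻¹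
  rw [modularLaw, withDensity_apply _ MeasurableSet.univ, Measure.restrict_univ]
  simp only [mul_assoc]
  rw [← ofReal_integral_eq_lintegral_ofReal hi, integral_const_mul, hg.2,
    inv_mul_cancel₀ (delta_pos m).ne', ENNReal.ofReal_one]
  filter_upwards [ae_restrict_mem measurableSet_Ioi] with q hq
  have := density_nonneg hg hq
  rwa [mul_assoc] at this

theorem ae_modularLaw_pos [NeZero m] (hg : g ∈ Gen m) (hc : ContinuousOn g (Ioi 0)) :
    ∀ᵐ q ∂modularLaw m g, 0 < q ∧ 0 < g q := by
  have h1 : ∀ᵐ q ∂modularLaw m g, q ∈ Ioi (0 : ℝ) :=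
    (modularLaw_ac m g).ae_le (ae_restrict_mem measurableSet_Ioi)
  have h2 : ∀ᵐ q ∂modularLaw m g,
      ENNReal.ofReal ((delta m)⁻¹ * q ^ ((m : ℝ) / 2 - 1) * g q) ≠ 0 := by
    exact (ae_withDensity_iff' (aemeasurable_density hc).coe_nnreal_ennreal).2
      (.of_forall fun q hq => hq)
  filter_upwards [h1, h2] with q hq hq2
  refine ⟨hq, lt_of_le_of_ne (hg.1 q hq) fun h0 => hq2 ?_⟩
  rw [← h0]; simp

theorem aestronglyMeasurable_phi (hc : ContinuousOn g (Ioi 0)) :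
    AEStronglyMeasurable (phi g) (modularLaw m g) := by
  have h1 : AEMeasurable g (modularLaw m g) :=
    (hc.aemeasurable measurableSet_Ioi).mono_ac (modularLaw_ac m g)
  exact ((h1.const_div (-2)).mul (measurable_deriv g).aemeasurable).aestronglyMeasurable

theorem deriv_eq_zero_of_eq_zero (hg : g ∈ Gen m) {q : ℝ} (hq : 0 < q) (h0 : g q = 0) :
    deriv g q = 0 := by
  refine IsLocalMin.deriv_eq_zero ?_
  filter_upwards [Ioi_mem_nhds hq] with t ht
  rw [h0]
  exact hg.1 t ht

/-- At a zero of `g` the division in `φ` returns zero, which is consistent with `g φ = -2 g'`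
because `g` has a minimum there. -/
theorem mul_phi_eq (hg : g ∈ Gen m) {q : ℝ} (hq : 0 < q) :
    g q * phi g q = -2 * deriv g q := by
  by_cases h0 : g q = 0
  · simp [h0, deriv_eq_zero_of_eq_zero hg hq h0]
  · unfold phi; field_simp

theorem memLp_mul_phi (hc : ContinuousOn g (Ioi 0))
    (hα : Integrable (fun q : ℝ => q ^ 2 * phi g q ^ 2) (modularLaw m g)) :
    MemLp (fun q => q * phi g q) 2 (modularLaw m g) := by
  refine (memLp_two_iff_integrable_sq
    (aestronglyMeasurable_id.mul (aestronglyMeasurable_phi hc))).2 ?_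
  simpa only [Pi.mul_apply, id, mul_pow] using hα

theorem integral_exp_comp (F : ℝ → ℝ) :
    ∫ u, Real.exp u * F (Real.exp u) = ∫ q in Ioi (0 : ℝ), F q := by
  have h := integral_image_eq_integral_abs_deriv_smul MeasurableSet.univ
    (fun x _ => (Real.hasDerivAt_exp x).hasDerivWithinAt) Real.exp_injective.injOn F
  rw [image_univ, Real.range_exp] at h
  rw [h]
  simp [Real.abs_exp]

theorem integrable_exp_comp_iff (F : ℝ → ℝ) :
    Integrable (fun u => Real.exp u * F (Real.exp u)) ↔ IntegrableOn F (Ioi (0 : ℝ)) := by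
  have h := integrableOn_image_iff_integrableOn_abs_deriv_smul MeasurableSet.univ
    (fun x _ => (Real.hasDerivAt_exp x).hasDerivWithinAt) Real.exp_injective.injOn F
  rw [image_univ, Real.range_exp] at h
  rw [h]
  simp [Real.abs_exp]

/-- Integration by parts: `E{𝒬 φ(𝒬)} = m`. After the substitution `q = exp u` the boundary terms
vanish because `q^(m/2) g(q)` and its derivative are integrable in `u`. -/
theorem integral_mul_phi [NeZero m] (hg : g ∈ Gen m) (hg1 : ContDiffOn ℝ 1 g (Ioi 0))
    (hα : Integrable (fun q : ℝ => q ^ 2 * phi g q ^ 2) (modularLaw m g)) :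
    ∫ q, q * phi g q ∂modularLaw m g = m := by
  have hc := hg1.continuousOn
  have := isProbabilityMeasure_modularLaw hg
  have hδ := delta_pos m
  have hd : ∀ q, 0 < q → HasDerivAt g (deriv g q) q := fun q hq =>
    ((hg1.differentiableOn one_ne_zero).differentiableAt (Ioi_mem_nhds hq)).hasDerivAt
  have hi : Integrable (fun q => q * phi g q) (modularLaw m g) :=
    (memLp_mul_phi hc hα).integrable one_le_two
  have hI := (integrable_modularLaw_iff hg hc _).1 hi
  have hE := integral_modularLaw hg hc fun q => q * phi g q
  have hg0 := integrableOn_of_mem_gen hg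
  set F : ℝ → ℝ := fun q => (m : ℝ) / 2 * (q ^ ((m : ℝ) / 2 - 1) * g q) -
    (delta m / 2) * ((delta m)⁻¹ * q ^ ((m : ℝ) / 2 - 1) * g q * (q * phi g q)) with hF
  have hFi : IntegrableOn F (Ioi 0) := (hg0.const_mul _).sub (hI.const_mul _)
  have hder : ∀ q, 0 < q → HasDerivAt (fun q : ℝ => q ^ ((m : ℝ) / 2) * g q) (F q) q := by
    intro q hq
    refine ((Real.hasDerivAt_rpow_const (p := (m : ℝ) / 2) (Or.inl hq.ne')).mul
      (hd q hq)).congr_deriv ?_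
    have h1 : q ^ ((m : ℝ) / 2) = q ^ ((m : ℝ) / 2 - 1) * q := by
      rw [Real.rpow_sub_one hq.ne']; field_simp
    have h2 := mul_phi_eq hg hq
    have h3 : deriv g q = -(g q * phi g q) / 2 := by rw [h2]; ring
    rw [hF, h1, h3]
    field_simp
    ring
  have hzero : ∫ u, Real.exp u * F (Real.exp u) = 0 := by
    refine integral_eq_zero_of_hasDerivAt_of_integrable
      (f := fun u => Real.exp u ^ ((m : ℝ) / 2) * g (Real.exp u)) (fun u => ?_)
      ((integrable_exp_comp_iff F).2 hFi) ?_
    · have := (hder _ (Real.exp_pos u)).comp u (Real.hasDerivAt_exp u)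
      rwa [mul_comm] at this
    · have h := (integrable_exp_comp_iff _).2 hg0
      refine h.congr (.of_forall fun u => ?_)
      simp only
      rw [Real.rpow_sub_one (Real.exp_pos u).ne']
      field_simp
  rw [integral_exp_comp, hF, integral_sub (hg0.const_mul _) (hI.const_mul _), integral_const_mul,
    integral_const_mul, ← hE, hg.2] at hzero
  have : (delta m / 2) * (m - ∫ q, q * phi g q ∂modularLaw m g) = 0 := by linarith
  have := (mul_eq_zero.1 this).resolve_left (by positivity)
  linarith

/-- Perturbing a generator by a bounded factor that integrates to zero gives a generator. -/
theorem perturb_mem_gen [NeZero m] (hg : g ∈ Gen m) (hc : ContinuousOn g (Ioi 0))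
    {h : ℝ → ℝ} {C : ℝ}
    (hC : ∀ q, |h q| ≤ C) (hi : Integrable h (modularLaw m g)) (h0 : ∫ q, h q ∂modularLaw m g = 0)
    {ρ : ℝ} (hρ : |ρ| * C ≤ 1) : (fun q => g q * (1 + ρ * h q)) ∈ Gen m := by
  refine ⟨fun t ht => mul_nonneg (hg.1 t ht) ?_, ?_⟩
  · have h1 : |ρ * h t| ≤ 1 := by
      rw [abs_mul]
      exact (mul_le_mul_of_nonneg_left (hC t) (abs_nonneg _)).trans hρ
    linarith [(abs_le.1 h1).1]
  · have hI := (integrable_modularLaw_iff hg hc _).1 hi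
    rw [integral_modularLaw hg hc] at h0
    have hδ := delta_pos m
    have : ∀ t : ℝ, t ^ ((m : ℝ) / 2 - 1) * (g t * (1 + ρ * h t)) =
        t ^ ((m : ℝ) / 2 - 1) * g t +
          (ρ * delta m) * ((delta m)⁻¹ * t ^ ((m : ℝ) / 2 - 1) * g t * h t) := by
      intro t; field_simp
    simp only [this]
    rw [integral_add (integrableOn_of_mem_gen hg) (hI.const_mul _), integral_const_mul, h0, hg.2]
    ring

theorem rescale_mem_gen {s : ℝ} (hs : 0 < s) (hg : g ∈ Gen m) : rescale m s g ∈ Gen m := by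
  refine ⟨fun t ht => ?_, ?_⟩
  · have := hg.1 (s⁻¹ * t) (by positivity)
    unfold rescale; positivity
  · have h := integral_comp_mul_left_Ioi (fun t => t ^ ((m : ℝ) / 2 - 1) * g t) 0 (inv_pos.2 hs)
    rw [mul_zero, hg.2, inv_inv, smul_eq_mul] at h
    have h2 : ∀ t ∈ Ioi (0 : ℝ), t ^ ((m : ℝ) / 2 - 1) * rescale m s g t =
        s⁻¹ * ((s⁻¹ * t) ^ ((m : ℝ) / 2 - 1) * g (s⁻¹ * t)) := by
      intro t ht
      have h3 : s ^ (-((m : ℝ) / 2)) = s⁻¹ * s⁻¹ ^ ((m : ℝ) / 2 - 1) := by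
        rw [Real.rpow_sub_one (inv_pos.2 hs).ne', Real.inv_rpow hs.le, Real.rpow_neg hs.le]
        field_simp
      rw [Real.mul_rpow (inv_pos.2 hs).le (le_of_lt ht), rescale, h3]
      ring
    rw [setIntegral_congr_fun measurableSet_Ioi h2, integral_const_mul, h]
    field_simp

end Modular

/-! ### The local parametrization of the shape matrices -/

section Shape

variable {m : ℕ}

theorem symMat_isSymm (c : VechIdx m → ℝ) : (symMat c).IsSymm := by
  ext i j
  simp [symMat, lowIdx, max_comm, min_comm]

theorem symMat_add (c d : VechIdx m → ℝ) : symMat (c + d) = symMat c + symMat d := by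
  ext i j; simp [symMat]

theorem symMat_smul (r : ℝ) (c : VechIdx m → ℝ) : symMat (r • c) = r • symMat c := by
  ext i j; simp [symMat]

theorem continuous_symMat : Continuous (symMat : (VechIdx m → ℝ) → Matrix (Fin m) (Fin m) ℝ) := by
  unfold symMat; fun_prop

/-- Positive definiteness is an open condition on the free entries: by compactness of the unit
sphere, the quadratic form stays bounded below there. -/
theorem isOpen_posDef : IsOpen {c : VechIdx m → ℝ | (symMat c).PosDef} := by
  have hiff : ∀ c : VechIdx m → ℝ, (symMat c).PosDef ↔
      ∀ x ∈ Metric.sphere (0 : Fin m → ℝ) 1, 0 < x ⬝ᵥ (symMat c *ᵥ x) := by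
    intro c
    constructor
    · intro h x hx
      have hx0 : x ≠ 0 := by
        rintro rfl; simp at hx
      simpa using h.dotProduct_mulVec_pos hx0
    · intro h
      refine Matrix.PosDef.of_dotProduct_mulVec_pos
        (by rw [Matrix.IsHermitian, Matrix.conjTranspose_eq_transpose_of_trivial]
            exact symMat_isSymm c) fun x hx => ?_
      have hn : 0 < ‖x‖ := norm_pos_iff.2 hx
      have h1 := h (‖x‖⁻¹ • x) (by simp [norm_smul, hn.ne'])
      rw [Matrix.mulVec_smul, dotProduct_smul, smul_dotProduct, smul_smul, smul_eq_mul] at h1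
      simpa using pos_of_mul_pos_right h1 (by positivity)
  have hset : {c : VechIdx m → ℝ | (symMat c).PosDef} =
      {c | ∀ x ∈ Metric.sphere (0 : Fin m → ℝ) 1,
        (c, x) ∈ {p : (VechIdx m → ℝ) × (Fin m → ℝ) | 0 < p.2 ⬝ᵥ (symMat p.1 *ᵥ p.2)}} := by
    ext c; exact hiff c
  have hopen : IsOpen {p : (VechIdx m → ℝ) × (Fin m → ℝ) | 0 < p.2 ⬝ᵥ (symMat p.1 *ᵥ p.2)} := by
    refine isOpen_lt continuous_const ?_
    exact continuous_snd.dotProduct ((continuous_symMat.comp continuous_fst).matrix_mulVec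
      continuous_snd)
  rw [hset, isOpen_iff_mem_nhds]
  intro c hc
  have h := (isCompact_sphere (0 : Fin m → ℝ) 1).eventually_forall_of_forall_eventually
    (x₀ := c) (P := fun c x =>
      (c, x) ∈ {p : (VechIdx m → ℝ) × (Fin m → ℝ) | 0 < p.2 ⬝ᵥ (symMat p.1 *ᵥ p.2)})
    fun x hx => hopen.mem_nhds (hc x hx)
  exact h

variable [NeZero m]

/-- `consTop` as a continuous linear map. -/
def consTopL (m : ℕ) [NeZero m] : ℝ × (OffIdx m → ℝ) →L[ℝ] (VechIdx m → ℝ) :=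
  LinearMap.toContinuousLinearMap
    { toFun := fun p => consTop p.1 p.2
      map_add' := fun p q => by
        ext k; by_cases h : k.1 = (0, 0) <;> simp [consTop, h]
      map_smul' := fun r p => by
        ext k; by_cases h : k.1 = (0, 0) <;> simp [consTop, h] }

theorem consTopL_apply (a : ℝ) (v : OffIdx m → ℝ) : consTopL m (a, v) = consTop a v := rfl

theorem consTop_one_zero : consTop (m := m) 1 0 = Pi.single (topIdx m) 1 := by
  ext k
  by_cases h : k.1 = (0, 0)
  · have : k = topIdx m := Subtype.ext h
    subst this
    simp [consTop, topIdx]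
  · have : k ≠ topIdx m := fun h' => h (by rw [h']; rfl)
    simp [consTop, h, this]

theorem posDef_consTop_of_mem_Icc {a b t : ℝ} {v : OffIdx m → ℝ}
    (ha : (symMat (consTop a v)).PosDef) (hb : (symMat (consTop b v)).PosDef)
    (ht : t ∈ Icc a b) : (symMat (consTop t v)).PosDef := by
  rcases eq_or_lt_of_le (ht.1.trans ht.2) with hab | hab
  · have : t = a := le_antisymm (ht.2.trans hab.ge) ht.1
    rwa [this]
  have hba : 0 < b - a := sub_pos.2 hab
  have h1 : consTop t v = ((b - t) / (b - a)) • consTop a v + ((t - a) / (b - a)) • consTop b v := by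
    simp only [← consTopL_apply, ← map_smul, ← map_add]
    congr 1
    ext1
    · simp; field_simp; ring
    · simp only [Prod.smul_mk, Prod.mk_add_mk, ← add_smul]
      have : (b - t) / (b - a) + (t - a) / (b - a) = 1 := by field_simp; ring
      rw [this, one_smul]
  rw [h1, symMat_add, symMat_smul, symMat_smul]
  rcases eq_or_lt_of_le ht.1 with h | h
  · rw [← h]
    simp only [sub_self, zero_div, zero_smul, add_zero]
    rw [div_self hba.ne', one_smul]; exact ha
  · exact Matrix.PosDef.posSemidef_add
      (ha.posSemidef.smul (div_nonneg (by linarith [ht.2]) hba.le))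
      (hb.smul (div_pos (sub_pos.2 h) hba))

variable {S : Matrix (Fin m) (Fin m) ℝ → ℝ}

/-- The derivative of a scale functional in the coordinates `(a, v)`. -/
theorem IsScale.hasFDerivAt (hS : IsScale S) {a : ℝ} {v : OffIdx m → ℝ}
    (h : (symMat (consTop a v)).PosDef) :
    HasFDerivAt (fun p : ℝ × (OffIdx m → ℝ) => S (symMat (consTop p.1 p.2)))
      ((fderiv ℝ (fun c => S (symMat c)) (consTop a v)).comp (consTopL m)) (a, v) := by
  have h1 : HasFDerivAt (fun c => S (symMat c)) (fderiv ℝ (fun c => S (symMat c)) (consTop a v))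
      (consTopL m (a, v)) := (hS.differentiable _ h).hasFDerivAt
  exact h1.comp (a, v) (consTopL m).hasFDerivAt

theorem IsScale.hasDerivAt (hS : IsScale S) {a : ℝ} {v : OffIdx m → ℝ}
    (h : (symMat (consTop a v)).PosDef) :
    HasDerivAt (fun t => S (symMat (consTop t v)))
      (fderiv ℝ (fun c => S (symMat c)) (consTop a v) (Pi.single (topIdx m) 1)) a := by
  have h1 : HasDerivAt (fun t : ℝ => (t, v)) ((1 : ℝ), (0 : OffIdx m → ℝ)) a :=
    (hasDerivAt_id a).prodMk (hasDerivAt_const a v)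
  have := (hS.hasFDerivAt h).comp_hasDerivAt a h1
  rw [ContinuousLinearMap.comp_apply, consTopL_apply, consTop_one_zero] at this
  exact this

/-- With the other entries fixed, at most one top-left entry gives a shape matrix (Rolle). -/
theorem IsScale.eq_of_eq_one (hS : IsScale S) {a b : ℝ} {v : OffIdx m → ℝ}
    (ha : (symMat (consTop a v)).PosDef) (hb : (symMat (consTop b v)).PosDef)
    (hab : S (symMat (consTop a v)) = S (symMat (consTop b v))) : a = b := by
  have key : ∀ a b : ℝ, (symMat (consTop a v)).PosDef → (symMat (consTop b v)).PosDef →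
      S (symMat (consTop a v)) = S (symMat (consTop b v)) → ¬ a < b := by
    intro a b ha hb hab hlt
    have hd : ∀ t ∈ Icc a b, HasDerivAt (fun t => S (symMat (consTop t v)))
      (fderiv ℝ (fun c => S (symMat c)) (consTop t v) (Pi.single (topIdx m) 1)) t :=
      fun t ht => hS.hasDerivAt (posDef_consTop_of_mem_Icc ha hb ht)
    obtain ⟨t, ht, ht0⟩ := exists_hasDerivAt_eq_zero hlt
      (fun t ht => (hd t ht).continuousAt.continuousWithinAt) hab
      fun t ht => hd t (Ioo_subset_Icc_self ht)
    exact hS.partial_ne_zero _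
      (posDef_consTop_of_mem_Icc ha hb (Ioo_subset_Icc_self ht)) ht0
  exact le_antisymm (not_lt.1 (key b a hb ha hab.symm)) (not_lt.1 (key a b ha hb hab))

theorem v11_eq (hS : IsScale S) {a : ℝ} {v : OffIdx m → ℝ}
    (ha : (symMat (consTop a v)).PosDef) (h1 : S (symMat (consTop a v)) = 1) : v11 S v = a := by
  have hex : ∃ a : ℝ, (symMat (consTop a v)).PosDef ∧ S (symMat (consTop a v)) = 1 := ⟨a, ha, h1⟩
  rw [v11, dif_pos hex]
  exact hS.eq_of_eq_one hex.choose_spec.1 ha (hex.choose_spec.2.trans h1.symm)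

theorem symMat_consTop_ovecs {V : Matrix (Fin m) (Fin m) ℝ} (hV : V.PosDef) :
    symMat (consTop (V 0 0) (ovecs V)) = V := by
  rw [consTop_ovecs, symMat_vecs]
  simpa [Matrix.IsHermitian, Matrix.IsSymm] using hV.1

theorem v11_ovecs (hS : IsScale S) {V : Matrix (Fin m) (Fin m) ℝ} (hV : V.PosDef)
    (hSV : S V = 1) : v11 S (ovecs V) = V 0 0 :=
  v11_eq hS (by rwa [symMat_consTop_ovecs hV]) (by rwa [symMat_consTop_ovecs hV])

theorem shapeMat_ovecs (hS : IsScale S) {V : Matrix (Fin m) (Fin m) ℝ} (hV : V.PosDef)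
    (hSV : S V = 1) : shapeMat S (ovecs V) = V := by
  rw [shapeMat, v11_ovecs hS hV hSV, symMat_consTop_ovecs hV]

/-- Near the free entries of a shape matrix the equation `S (V) = 1` has a solution in any
prescribed neighbourhood of the top-left entry. Only the sign of `∂S/∂Σ₁₁` at the given matrix and
the intermediate value theorem are used, since `S` need not be continuously differentiable. -/
theorem eventually_v11 (hS : IsScale S) {a : ℝ} {v : OffIdx m → ℝ}
    (ha : (symMat (consTop a v)).PosDef) (h1 : S (symMat (consTop a v)) = 1)
    {ε : ℝ} (hε : 0 < ε) :
    ∀ᶠ w in 𝓝 v, |v11 S w - a| ≤ ε ∧ S (symMat (consTop (v11 S w) w)) = 1 := by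
  set c := fderiv ℝ (fun c => S (symMat c)) (consTop a v) (Pi.single (topIdx m) 1) with hc
  have hc0 : c ≠ 0 := hS.partial_ne_zero _ ha
  -- Multiplication by `c` makes the partial derivative positive.
  set f : ℝ × (OffIdx m → ℝ) → ℝ := fun p => c * (S (symMat (consTop p.1 p.2)) - 1) with hf
  have hder : HasDerivAt (fun t => f (t, v)) (c * c) a := ((hS.hasDerivAt ha).sub_const 1).const_mul c
  have hfa : f (a, v) = 0 := by simp [hf, h1]
  have hpos : (0 : ℝ) < c * c := mul_self_pos.2 hc0
  have hslope := hasDerivAt_iff_tendsto_slope.1 hder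
  have hev : ∀ᶠ t in 𝓝[≠] a, 0 < slope (fun t => f (t, v)) a t :=
    hslope.eventually (lt_mem_nhds hpos)
  have hpd : ∀ᶠ p in 𝓝 (a, v), (symMat (consTop p.1 p.2)).PosDef :=
    (consTopL m).continuous.continuousAt.eventually (isOpen_posDef.mem_nhds ha)
  have hpd1 : ∀ᶠ t in 𝓝 a, (symMat (consTop t v)).PosDef :=
    (Continuous.prodMk_left v).continuousAt.eventually hpd
  rw [eventually_nhdsWithin_iff] at hev
  obtain ⟨r, hr, hball⟩ := Metric.eventually_nhds_iff.1 (hev.and hpd1)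
  set η := min (r / 2) ε with hη
  have hη0 : 0 < η := lt_min (half_pos hr) hε
  have hηr : η < r := (min_le_left _ _).trans_lt (half_lt_self hr)
  have hp := hball (y := a + η) (by rw [Real.dist_eq]; simpa [abs_of_pos hη0] using hηr)
  have hm := hball (y := a - η) (by rw [Real.dist_eq]; simpa [abs_of_pos hη0] using hηr)
  have hfp : 0 < f (a + η, v) := by
    have := hp.1 (by simpa using hη0.ne')
    rw [slope_def_field] at this
    simpa [hfa, hη0] using this
  have hfm : f (a - η, v) < 0 := by
    have := hm.1 (by simpa using hη0.ne')
    rw [slope_def_field] at this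
    have h3 : a - η - a = -η := by ring
    rw [hfa, sub_zero, h3, div_neg, neg_pos, div_neg_iff] at this
    rcases this with h | h
    · linarith [h.2]
    · exact h.1
  have hnear : ∀ t, (symMat (consTop t v)).PosDef → ContinuousAt (fun w => f (t, w)) v ∧
      ∀ᶠ w in 𝓝 v, (symMat (consTop t w)).PosDef := by
    intro t ht
    have hcw : ContinuousAt (fun w : OffIdx m → ℝ => (t, w)) v :=
      (Continuous.prodMk_right t).continuousAt
    refine ⟨?_, ?_⟩
    · have : ContinuousAt f (t, v) :=
        ((hS.hasFDerivAt ht).continuousAt.sub continuousAt_const).const_mul _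
      exact this.comp hcw
    · exact hcw.eventually ((consTopL m).continuous.continuousAt.eventually
        (isOpen_posDef.mem_nhds ht))
  filter_upwards [(hnear _ hp.2).1.eventually (lt_mem_nhds hfp),
    (hnear _ hm.2).1.eventually (gt_mem_nhds hfm), (hnear _ hp.2).2, (hnear _ hm.2).2]
    with w w1 w2 w3 w4
  have hIcc : ∀ t ∈ Icc (a - η) (a + η), (symMat (consTop t w)).PosDef :=
    fun t ht => posDef_consTop_of_mem_Icc w4 w3 ht
  obtain ⟨t, ht, ht0⟩ := intermediate_value_Icc (by linarith)
    (f := fun t => f (t, w)) (fun t ht => ((((hS.hasDerivAt (hIcc t ht)).sub_const 1).const_mul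
      c).continuousAt).continuousWithinAt) ⟨w2.le, w1.le⟩
  have hSt : S (symMat (consTop t w)) = 1 := by
    have := (mul_eq_zero.1 ht0).resolve_left hc0
    linarith
  have hv : v11 S w = t := v11_eq hS (hIcc t ht) hSt
  rw [hv]
  refine ⟨?_, hSt⟩
  rw [abs_le]
  constructor <;> linarith [ht.1, ht.2, min_le_right (r / 2) ε]

/-- The implicit function `v ↦ V₁₁` is differentiable at the free entries of a shape matrix. -/
theorem differentiableAt_v11 (hS : IsScale S) {a : ℝ} {v : OffIdx m → ℝ}
    (ha : (symMat (consTop a v)).PosDef) (h1 : S (symMat (consTop a v)) = 1) :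
    DifferentiableAt ℝ (v11 S) v := by
  have hv : v11 S v = a := v11_eq hS ha h1
  have hcont : ContinuousAt (v11 S) v := by
    rw [Metric.continuousAt_iff']
    intro ε hε
    filter_upwards [eventually_v11 hS ha h1 (half_pos hε)] with w hw
    rw [Real.dist_eq, hv]
    linarith [hw.1]
  set L := (fderiv ℝ (fun c => S (symMat c)) (consTop a v)).comp (consTopL m) with hL
  set c := L (1, 0) with hc
  have hc0 : c ≠ 0 := by
    rw [hc, hL, ContinuousLinearMap.comp_apply, consTopL_apply, consTop_one_zero]
    exact hS.partial_ne_zero _ ha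
  have hsplit : ∀ p : ℝ × (OffIdx m → ℝ), L p = c * p.1 + L (0, p.2) := by
    intro p
    have : p = p.1 • ((1 : ℝ), (0 : OffIdx m → ℝ)) + (0, p.2) := by ext <;> simp
    conv_lhs => rw [this]
    rw [map_add, map_smul, smul_eq_mul, mul_comm]
  -- The local left inverse of `v ↦ (V₁₁, v)` is `(a, v) ↦ (S, v)`.
  let e : (ℝ × (OffIdx m → ℝ)) ≃L[ℝ] (ℝ × (OffIdx m → ℝ)) :=
    ContinuousLinearEquiv.equivOfInverse (L.prod (ContinuousLinearMap.snd ℝ ℝ _))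
      ((c⁻¹ • (ContinuousLinearMap.fst ℝ ℝ _ -
        L.comp ((ContinuousLinearMap.inr ℝ ℝ _).comp (ContinuousLinearMap.snd ℝ ℝ _)))).prod
        (ContinuousLinearMap.snd ℝ ℝ _))
      (fun p => by
        ext1
        · simp [hsplit p]; field_simp
        · simp)
      (fun p => by
        ext1
        · simp only [ContinuousLinearMap.prod_apply]
          rw [hsplit]
          simp
          field_simp
          ring
        · simp)
  have hF : HasFDerivAt (fun p : ℝ × (OffIdx m → ℝ) => (S (symMat (consTop p.1 p.2)), p.2))
      (e : (ℝ × (OffIdx m → ℝ)) →L[ℝ] (ℝ × (OffIdx m → ℝ))) (v11 S v, v) := by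
    rw [hv]
    exact (hS.hasFDerivAt ha).prodMk hasFDerivAt_snd
  have hlin : HasFDerivAt (fun w : OffIdx m → ℝ => ((1 : ℝ), w))
      (ContinuousLinearMap.inr ℝ ℝ (OffIdx m → ℝ)) v := hasFDerivAt_prodMk_right 1 v
  have hg : HasFDerivAt (fun w => (v11 S w, w))
      ((e.symm : (ℝ × (OffIdx m → ℝ)) →L[ℝ] (ℝ × (OffIdx m → ℝ))).comp
        (ContinuousLinearMap.inr ℝ ℝ (OffIdx m → ℝ))) v := by
    refine hF.of_comp_of_leftInverse (f'symm := (e.symm : (ℝ × (OffIdx m → ℝ)) →L[ℝ] (ℝ × (OffIdx m → ℝ))))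
      (hcont.prodMk continuousAt_id) hlin ?_ e.symm_apply_apply
    filter_upwards [eventually_v11 hS ha h1 one_pos] with w hw
    simp [hw.2]
  exact hg.fst.differentiableAt

/-- The derivative of the shape matrix along the free entry `k`, i.e. the symmetric matrix whose
`vecs` is the `k`-th column of `K_V`. -/
def shapeDeriv (S : Matrix (Fin m) (Fin m) ℝ → ℝ) (V : Matrix (Fin m) (Fin m) ℝ) (k : OffIdx m) :
    Matrix (Fin m) (Fin m) ℝ :=
  symMat fun l => KMat S V l k

theorem KMat_col (V : Matrix (Fin m) (Fin m) ℝ) (k : OffIdx m) :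
    (fun l => KMat S V l k) =
      consTop (fderiv ℝ (v11 S) (ovecs V) (Pi.single k 1)) (Pi.single k 1) := by
  ext l
  by_cases h : l.1 = (0, 0)
  · have hl : l = topIdx m := Subtype.ext h
    subst hl
    simp [KMat, consTop, topIdx]
  · have hl : l ≠ topIdx m := fun h' => h (by rw [h']; rfl)
    have : (l.1 = k.1) ↔ ((⟨l.1, l.2, h⟩ : OffIdx m) = k) := by
      rw [Subtype.ext_iff]
    simp [KMat, consTop, h, hl, Pi.single_apply, this]

theorem hasDerivAt_shapeMat (hS : IsScale S) {V : Matrix (Fin m) (Fin m) ℝ} (hV : V.PosDef)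
    (hSV : S V = 1) (k : OffIdx m) (i j : Fin m) :
    HasDerivAt (fun t => shapeMat S (Function.update (ovecs V) k t) i j)
      (shapeDeriv S V k i j) (ovecs V k) := by
  have hdiff : DifferentiableAt ℝ (v11 S) (ovecs V) :=
    differentiableAt_v11 hS (a := V 0 0) (by rwa [symMat_consTop_ovecs hV])
      (by rwa [symMat_consTop_ovecs hV])
  have hup : HasDerivAt (Function.update (ovecs V) k) (Pi.single k 1) (ovecs V k) :=
    hasDerivAt_update (ovecs V) k (ovecs V k)
  have h1 : HasDerivAt (fun t => v11 S (Function.update (ovecs V) k t))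
      (fderiv ℝ (v11 S) (ovecs V) (Pi.single k 1)) (ovecs V k) := by
    have h0 : HasFDerivAt (v11 S) (fderiv ℝ (v11 S) (ovecs V))
        (Function.update (ovecs V) k (ovecs V k)) := by
      rw [Function.update_eq_self]
      exact hdiff.hasFDerivAt
    exact h0.comp_hasDerivAt (ovecs V k) hup
  have h2 : HasDerivAt (fun t => consTop (v11 S (Function.update (ovecs V) k t))
      (Function.update (ovecs V) k t))
      (consTop (fderiv ℝ (v11 S) (ovecs V) (Pi.single k 1)) (Pi.single k 1)) (ovecs V k) :=
    (consTopL m).hasFDerivAt.comp_hasDerivAt (ovecs V k) (h1.prodMk hup)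
  have h3 := (hasDerivAt_pi.1 h2) (lowIdx i j)
  rw [shapeDeriv, KMat_col]
  exact h3

end Shape

/-! ### Matrix calculus -/

section Calculus

variable {m : ℕ}

/-- Jacobi's formula at an invertible matrix. -/
theorem hasDerivAt_det {M : ℝ → Matrix (Fin m) (Fin m) ℝ} {M' : Matrix (Fin m) (Fin m) ℝ} {t₀ : ℝ}
    (hM : ∀ i j, HasDerivAt (fun t => M t i j) (M' i j) t₀) (hdet : (M t₀).det ≠ 0) :
    HasDerivAt (fun t => (M t).det) ((M t₀).det * ((M t₀)⁻¹ * M').trace) t₀ := by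
  let f : ContinuousMultilinearMap ℝ (fun _ : Fin m => Fin m → ℝ) ℝ :=
    ⟨(Matrix.detRowAlternating (n := Fin m) (R := ℝ)).toMultilinearMap,
      Continuous.matrix_det continuous_id⟩
  have hM2 : HasDerivAt (fun t => (fun i => M t i : Fin m → Fin m → ℝ)) (fun i => M' i) t₀ :=
    hasDerivAt_pi.2 fun i => hasDerivAt_pi.2 fun j => hM i j
  have h : HasDerivAt (fun t => (M t).det) (f.linearDeriv (M t₀) M') t₀ :=
    HasFDerivAt.comp_hasDerivAt t₀ (f.hasFDerivAt (M t₀)) hM2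
  refine h.congr_deriv ((ContinuousMultilinearMap.linearDeriv_apply f _ _).trans ?_)
  have h1 : ∀ i, f (Function.update (M t₀) i (M' i)) = (M' * (M t₀).adjugate) i i := by
    intro i
    change ((M t₀).updateRow i (M' i)).det = _
    rw [← Matrix.cramer_transpose_apply, Matrix.cramer_eq_adjugate_mulVec,
      ← Matrix.adjugate_transpose, Matrix.mulVec_transpose, Matrix.mul_apply_eq_vecMul]
  have h2 : (M t₀).adjugate = (M t₀).det • (M t₀)⁻¹ := by
    rw [Matrix.inv_def, Ring.inverse_eq_inv', smul_smul, mul_inv_cancel₀ hdet, one_smul]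
  simp only [h1]
  change (M' * (M t₀).adjugate).trace = _
  rw [h2, Matrix.mul_smul, Matrix.trace_smul, smul_eq_mul, Matrix.trace_mul_comm]

theorem hasDerivAt_quadInv {M : ℝ → Matrix (Fin m) (Fin m) ℝ} {M' : Matrix (Fin m) (Fin m) ℝ}
    {t₀ : ℝ} (hM : ∀ i j, HasDerivAt (fun t => M t i j) (M' i j) t₀) (hdet : (M t₀).det ≠ 0)
    (z : Fin m → ℝ) :
    HasDerivAt (fun t => quadInv (M t) z) (-(z ⬝ᵥ (((M t₀)⁻¹ * M' * (M t₀)⁻¹) *ᵥ z))) t₀ := by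
  have hcont : ContinuousAt M t₀ := by
    refine continuousAt_pi.2 fun i => continuousAt_pi.2 fun j => (hM i j).continuousAt
  have hdcont : ContinuousAt (fun t => (M t).det) t₀ := (hasDerivAt_det hM hdet).continuousAt
  have hev : ∀ᶠ t in 𝓝 t₀, (M t).det ≠ 0 := hdcont.eventually_ne hdet
  have hinv : ContinuousAt (fun t => (M t)⁻¹) t₀ := by
    simp only [Matrix.inv_def, Ring.inverse_eq_inv']
    exact (hdcont.inv₀ hdet).smul
      ((Continuous.matrix_adjugate continuous_id).continuousAt.comp hcont)
  have hslopeM : Tendsto (fun t => (t - t₀)⁻¹ • (M t - M t₀)) (𝓝[≠] t₀) (𝓝 M') := by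
    refine tendsto_pi_nhds.2 fun i => tendsto_pi_nhds.2 fun j => ?_
    have := hasDerivAt_iff_tendsto_slope.1 (hM i j)
    exact this.congr fun t => by simp [slope_def_field, div_eq_inv_mul]
  have hlim : Tendsto (fun t => -(z ⬝ᵥ (((M t)⁻¹ * ((t - t₀)⁻¹ • (M t - M t₀)) * (M t₀)⁻¹) *ᵥ z)))
      (𝓝[≠] t₀) (𝓝 (-(z ⬝ᵥ (((M t₀)⁻¹ * M' * (M t₀)⁻¹) *ᵥ z)))) := by
    have hc : Continuous fun p : Matrix (Fin m) (Fin m) ℝ × Matrix (Fin m) (Fin m) ℝ =>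
        -(z ⬝ᵥ ((p.1 * p.2 * (M t₀)⁻¹) *ᵥ z)) := by
      refine (continuous_const.dotProduct ?_).neg
      exact (((continuous_fst.matrix_mul continuous_snd).matrix_mul continuous_const)).matrix_mulVec
        continuous_const
    have hpair : Tendsto (fun t => ((M t)⁻¹, (t - t₀)⁻¹ • (M t - M t₀))) (𝓝[≠] t₀)
        (𝓝 ((M t₀)⁻¹, M')) :=
      Tendsto.prodMk_nhds (hinv.tendsto.mono_left nhdsWithin_le_nhds) hslopeM
    have hcomp := (hc.tendsto ((M t₀)⁻¹, M')).comp hpair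
    exact hcomp
  rw [hasDerivAt_iff_tendsto_slope]
  refine hlim.congr' ?_
  filter_upwards [nhdsWithin_le_nhds hev] with t ht
  -- The resolvent identity `A⁻¹ - B⁻¹ = -A⁻¹ (A - B) B⁻¹`.
  have hres : (M t)⁻¹ * (M t - M t₀) * (M t₀)⁻¹ = (M t₀)⁻¹ - (M t)⁻¹ := by
    rw [Matrix.mul_sub, Matrix.sub_mul, Matrix.nonsing_inv_mul _ (isUnit_iff_ne_zero.2 ht),
      Matrix.one_mul, Matrix.mul_assoc, Matrix.mul_nonsing_inv _ (isUnit_iff_ne_zero.2 hdet),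
      Matrix.mul_one]
  rw [Matrix.mul_smul, Matrix.smul_mul, hres, slope_def_field, quadInv, quadInv,
    Matrix.smul_mulVec, dotProduct_smul, Matrix.sub_mulVec, dotProduct_sub, smul_eq_mul]
  ring

theorem hasDerivAt_quadInv_translate {V : Matrix (Fin m) (Fin m) ℝ} (hV : V.IsSymm)
    (x μ : Fin m → ℝ) (i : Fin m) :
    HasDerivAt (fun t => quadInv V (x - Function.update μ i t))
      (-2 * (V⁻¹ *ᵥ (x - μ)) i) (μ i) := by
  have hW : (V⁻¹)ᵀ = V⁻¹ := by rw [Matrix.transpose_nonsing_inv, hV]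
  have hz : ∀ t, x - Function.update μ i t = (x - μ) + (μ i - t) • Pi.single i 1 := by
    intro t; ext j
    by_cases h : j = i
    · subst h; simp
    · simp [h]
  have hq : ∀ t, quadInv V (x - Function.update μ i t) =
      quadInv V (x - μ) + 2 * (μ i - t) * (V⁻¹ *ᵥ (x - μ)) i +
        (μ i - t) ^ 2 * V⁻¹ i i := by
    intro t
    have h1 : (x - μ) ⬝ᵥ (V⁻¹ *ᵥ Pi.single i 1) = (V⁻¹ *ᵥ (x - μ)) i := by
      rw [Matrix.dotProduct_mulVec, ← Matrix.mulVec_transpose, hW, dotProduct_single, mul_one]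
    rw [hz, quadInv, quadInv, Matrix.mulVec_add, Matrix.mulVec_smul, add_dotProduct,
      dotProduct_add, dotProduct_add, dotProduct_smul, h1, smul_dotProduct, smul_dotProduct,
      dotProduct_smul, single_dotProduct, single_dotProduct]
    simp
    ring
  simp only [hq]
  have hd : HasDerivAt (fun t : ℝ => μ i - t) (-1) (μ i) := (hasDerivAt_id _).const_sub _
  refine (((hd.const_mul 2).mul_const ((V⁻¹ *ᵥ (x - μ)) i)).const_add (quadInv V (x - μ))
    |>.add ((hd.pow 2).mul_const (V⁻¹ i i))).congr_deriv ?_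
  simp

theorem isSymm_of_posDef {V : Matrix (Fin m) (Fin m) ℝ} (hV : V.PosDef) : V.IsSymm := by
  simpa [Matrix.IsHermitian, Matrix.IsSymm] using hV.1

/-- The logarithmic derivative of `c · g(r)`. -/
theorem deriv_log_mul_comp {c r g : ℝ → ℝ} {t₀ c' r' : ℝ} (hc : HasDerivAt c c' t₀)
    (hc0 : c t₀ ≠ 0) (hr : HasDerivAt r r' t₀) (hg : DifferentiableAt ℝ g (r t₀))
    (hg0 : g (r t₀) ≠ 0) :
    deriv (fun t => Real.log (c t * g (r t))) t₀ = c' / c t₀ - 1 / 2 * phi g (r t₀) * r' := by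
  have h1 : HasDerivAt (fun t => c t * g (r t)) (c' * g (r t₀) + c t₀ * (deriv g (r t₀) * r')) t₀ :=
    hc.mul (hg.hasDerivAt.comp t₀ hr)
  rw [(h1.log (mul_ne_zero hc0 hg0)).deriv, phi]
  field_simp
  ring

end Calculus

/-! ### The scores -/

section Scores

variable {m : ℕ} [NeZero m] {S : Matrix (Fin m) (Fin m) ℝ → ℝ} {V : Matrix (Fin m) (Fin m) ℝ}
  {μ : Fin m → ℝ} {s : ℝ} {g : ℝ → ℝ}

theorem pdfU_rescale (γ : GammaIdx m → ℝ) (s : ℝ) (g : ℝ → ℝ) :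
    pdfU S γ (rescale m s g) = pdfC S γ s g := by
  ext x
  simp only [pdfU, pdfC, rescale]
  ring

theorem scoreU_rescale (γ : GammaIdx m → ℝ) (s : ℝ) (g : ℝ → ℝ) :
    scoreU S γ (rescale m s g) = scoreC S γ s g := by
  simp only [scoreU, scoreC, pdfU_rescale]

theorem pdfC_gammaOf (hS : IsScale S) (hV : V.PosDef) (hSV : S V = 1) (s : ℝ) (g : ℝ → ℝ)
    (x : Fin m → ℝ) : pdfC S (gammaOf μ V) s g x =
      s ^ (-((m : ℝ) / 2)) * V.det ^ (-(1 / 2) : ℝ) * g (s⁻¹ * quadInv V (x - μ)) := by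
  have h1 : gammaOf μ V ∘ Sum.inr = ovecs V := rfl
  have h2 : gammaOf μ V ∘ Sum.inl = μ := rfl
  rw [pdfC, h1, h2, shapeMat_ovecs hS hV hSV]

theorem score_location (hS : IsScale S) (hV : V.PosDef) (hSV : S V = 1) (hs : 0 < s)
    {x : Fin m → ℝ} (hg : DifferentiableAt ℝ g (s⁻¹ * quadInv V (x - μ)))
    (hg0 : g (s⁻¹ * quadInv V (x - μ)) ≠ 0) (i : Fin m) :
    scoreC S (gammaOf μ V) s g (Sum.inl i) x =
      phi g (s⁻¹ * quadInv V (x - μ)) * (s⁻¹ * (V⁻¹ *ᵥ (x - μ)) i) := by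
  have hdet := hV.det_pos
  have hfun : ∀ t, pdfC S (Function.update (gammaOf μ V) (Sum.inl i) t) s g x =
      s ^ (-((m : ℝ) / 2)) * V.det ^ (-(1 / 2) : ℝ) *
        g (s⁻¹ * quadInv V (x - Function.update μ i t)) := by
    intro t
    have h1 : Function.update (gammaOf μ V) (Sum.inl i) t = gammaOf (Function.update μ i t) V := by
      rw [gammaOf, Sum.update_elim_inl, gammaOf]
    rw [h1, pdfC_gammaOf hS hV hSV]
  have hr := (hasDerivAt_quadInv_translate (isSymm_of_posDef hV) x μ i).const_mul s⁻¹
  have hup : Function.update μ i (μ i) = μ := Function.update_eq_self i μ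
  have h := deriv_log_mul_comp (g := g)
    (hasDerivAt_const (μ i) (s ^ (-((m : ℝ) / 2)) * V.det ^ (-(1 / 2) : ℝ)))
    (by positivity) hr (by rwa [hup]) (by rwa [hup])
  simp only [scoreC, score, hfun]
  change deriv _ (μ i) = _
  rw [h, hup]
  ring

theorem score_shape (hS : IsScale S) (hV : V.PosDef) (hSV : S V = 1) (hs : 0 < s)
    {x : Fin m → ℝ} (hg : DifferentiableAt ℝ g (s⁻¹ * quadInv V (x - μ)))
    (hg0 : g (s⁻¹ * quadInv V (x - μ)) ≠ 0) (k : OffIdx m) :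
    scoreC S (gammaOf μ V) s g (Sum.inr k) x =
      1 / 2 * (phi g (s⁻¹ * quadInv V (x - μ)) *
        (s⁻¹ * ((x - μ) ⬝ᵥ ((V⁻¹ * shapeDeriv S V k * V⁻¹) *ᵥ (x - μ)))) -
          (V⁻¹ * shapeDeriv S V k).trace) := by
  have hdet := hV.det_pos
  have hfun : ∀ t, pdfC S (Function.update (gammaOf μ V) (Sum.inr k) t) s g x =
      s ^ (-((m : ℝ) / 2)) * (shapeMat S (Function.update (ovecs V) k t)).det ^ (-(1 / 2) : ℝ) *
        g (s⁻¹ * quadInv (shapeMat S (Function.update (ovecs V) k t)) (x - μ)) := by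
    intro t
    have h1 : Function.update (gammaOf μ V) (Sum.inr k) t =
        Sum.elim μ (Function.update (ovecs V) k t) := by
      rw [gammaOf, Sum.update_elim_inr]
    have h2 : Sum.elim μ (Function.update (ovecs V) k t) ∘ Sum.inr =
      Function.update (ovecs V) k t := rfl
    have h3 : Sum.elim μ (Function.update (ovecs V) k t) ∘ Sum.inl = μ := rfl
    rw [h1, pdfC, h2, h3]
  have hM := hasDerivAt_shapeMat hS hV hSV k
  have hV0 : shapeMat S (Function.update (ovecs V) k (ovecs V k)) = V := by
    rw [Function.update_eq_self, shapeMat_ovecs hS hV hSV]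
  have hdet0 : (shapeMat S (Function.update (ovecs V) k (ovecs V k))).det ≠ 0 := by
    rw [hV0]; exact hdet.ne'
  have hd := hasDerivAt_det hM hdet0
  have hr := (hasDerivAt_quadInv hM hdet0 (x - μ)).const_mul s⁻¹
  have hc := (hd.rpow_const (p := (-(1 / 2) : ℝ)) (Or.inl hdet0)).const_mul (s ^ (-((m : ℝ) / 2)))
  have h := deriv_log_mul_comp (g := g) hc (by rw [hV0]; positivity) hr
    (by rwa [hV0]) (by rwa [hV0])
  simp only [scoreC, score, hfun]
  change deriv _ (ovecs V k) = _
  rw [h, hV0, Real.rpow_sub_one hdet.ne']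
  have : V.det ^ (-(1 / 2) : ℝ) ≠ 0 := by positivity
  have : s ^ (-((m : ℝ) / 2)) ≠ 0 := by positivity
  field_simp
  ring

theorem score_scale (hS : IsScale S) (hV : V.PosDef) (hSV : S V = 1) (hs : 0 < s)
    {x : Fin m → ℝ} (hg : DifferentiableAt ℝ g (s⁻¹ * quadInv V (x - μ)))
    (hg0 : g (s⁻¹ * quadInv V (x - μ)) ≠ 0) :
    scoreS S (gammaOf μ V) s g x =
      (2 * s)⁻¹ * (s⁻¹ * quadInv V (x - μ) * phi g (s⁻¹ * quadInv V (x - μ)) - m) := by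
  have hdet := hV.det_pos
  have hfun : ∀ t, scaleModel S (gammaOf μ V) g (Function.update (fun _ => s) () t) x =
      t ^ (-((m : ℝ) / 2)) * V.det ^ (-(1 / 2) : ℝ) * g (t⁻¹ * quadInv V (x - μ)) := by
    intro t
    rw [scaleModel, Function.update_self, pdfC_gammaOf hS hV hSV]
  have hc := ((hasDerivAt_id s).rpow_const (p := -((m : ℝ) / 2))
    (Or.inl hs.ne')).mul_const (V.det ^ (-(1 / 2) : ℝ))
  have hr := (hasDerivAt_inv hs.ne').mul_const (quadInv V (x - μ))
  have h := deriv_log_mul_comp (g := g) hc (by simp only [id]; positivity) hr hg hg0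
  simp only [scoreS, score, hfun]
  simp only [id] at h
  rw [h, Real.rpow_sub_one hs.ne']
  have : V.det ^ (-(1 / 2) : ℝ) ≠ 0 := by positivity
  have : s ^ (-((m : ℝ) / 2)) ≠ 0 := by positivity
  field_simp
  ring

end Scores

/-! ### Standardization of the elliptical distribution -/

section Whitening

variable {m : ℕ} {V A : Matrix (Fin m) (Fin m) ℝ} {μ : Fin m → ℝ} {s : ℝ} {g : ℝ → ℝ}

/-- `A` is a square root of `s V`, so that `x = μ + A y` with a spherical `y`. -/
structure IsRoot (A V : Matrix (Fin m) (Fin m) ℝ) (s : ℝ) : Prop where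
  mul_transpose : A * Aᵀ = s • V
  det_ne_zero : A.det ≠ 0

open scoped MatrixOrder in
theorem exists_isRoot (hV : V.PosDef) (hs : 0 < s) : ∃ A, IsRoot A V s := by
  have hP : (s • V).PosDef := hV.smul hs
  have h0 : 0 ≤ s • V := Matrix.nonneg_iff_posSemidef.2 hP.posSemidef
  have hmul : CFC.sqrt (s • V) * CFC.sqrt (s • V) = s • V := CFC.sqrt_mul_sqrt_self _ h0
  have hsa : (CFC.sqrt (s • V))ᵀ = CFC.sqrt (s • V) := by
    have := (Matrix.nonneg_iff_posSemidef.1 (CFC.sqrt_nonneg (s • V))).1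
    rwa [Matrix.IsHermitian, Matrix.conjTranspose_eq_transpose_of_trivial] at this
  refine ⟨CFC.sqrt (s • V), by rw [hsa, hmul], fun hd => ?_⟩
  have := hP.det_pos
  rw [← hmul, Matrix.det_mul, hd, mul_zero] at this
  exact this.false

/-- The affine map `y ↦ μ + A y`. -/
def affine (μ : Fin m → ℝ) (A : Matrix (Fin m) (Fin m) ℝ) (y : Fin m → ℝ) : Fin m → ℝ :=
  μ + A *ᵥ y

theorem affine_sub (y : Fin m → ℝ) : affine μ A y - μ = A *ᵥ y := by simp [affine]

theorem continuous_affine : Continuous (affine μ A) := by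
  unfold affine; fun_prop

namespace IsRoot

theorem inv_mul (hA : IsRoot A V s) : A⁻¹ * A = 1 :=
  Matrix.nonsing_inv_mul _ (isUnit_iff_ne_zero.2 hA.det_ne_zero)

theorem inv_smul (hA : IsRoot A V s) : (s • V)⁻¹ = (A⁻¹)ᵀ * A⁻¹ := by
  rw [← hA.mul_transpose, Matrix.mul_inv_rev, Matrix.transpose_nonsing_inv]

theorem inv_eq (hA : IsRoot A V s) (hs : 0 < s) : V⁻¹ = s • ((A⁻¹)ᵀ * A⁻¹) := by
  have h1 : V⁻¹ = s • (s • V)⁻¹ := by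
    have hVd : IsUnit V.det := by
      rw [isUnit_iff_ne_zero]
      intro h0
      have := congrArg Matrix.det hA.mul_transpose
      rw [Matrix.det_mul, Matrix.det_smul, Matrix.det_transpose, h0, mul_zero] at this
      exact hA.det_ne_zero (mul_self_eq_zero.1 this)
    have h2 : (s • V)⁻¹ = s⁻¹ • V⁻¹ := by
      refine Matrix.inv_eq_right_inv ?_
      rw [Matrix.smul_mul, Matrix.mul_smul, smul_smul, mul_inv_cancel₀ hs.ne', one_smul,
        Matrix.mul_nonsing_inv _ hVd]
    rw [h2, smul_smul, mul_inv_cancel₀ hs.ne', one_smul]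
  rw [h1, hA.inv_smul]

theorem affine_injective (hA : IsRoot A V s) : Function.Injective (affine μ A) := by
  intro y y' h
  have h1 : A *ᵥ y = A *ᵥ y' := add_left_cancel h
  have h2 := congrArg (A⁻¹ *ᵥ ·) h1
  simpa [Matrix.mulVec_mulVec, hA.inv_mul] using h2

theorem measurableEmbedding (hA : IsRoot A V s) : MeasurableEmbedding (affine μ A) :=
  continuous_affine.measurableEmbedding hA.affine_injective

theorem inv_mulVec (hA : IsRoot A V s) (y : Fin m → ℝ) : A⁻¹ *ᵥ (A *ᵥ y) = y := by
  rw [Matrix.mulVec_mulVec, hA.inv_mul, Matrix.one_mulVec]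

theorem inv_mulVec_apply (hA : IsRoot A V s) (hs : 0 < s) (y : Fin m → ℝ) :
    s⁻¹ • (V⁻¹ *ᵥ (A *ᵥ y)) = (A⁻¹)ᵀ *ᵥ y := by
  rw [hA.inv_eq hs, Matrix.smul_mulVec, smul_smul, inv_mul_cancel₀ hs.ne', one_smul,
    ← Matrix.mulVec_mulVec, hA.inv_mulVec]

theorem quadInv_affine (hA : IsRoot A V s) (hs : 0 < s) (y : Fin m → ℝ) :
    s⁻¹ * quadInv V (affine μ A y - μ) = normSq y := by
  rw [affine_sub, quadInv, ← smul_eq_mul, ← dotProduct_smul, hA.inv_mulVec_apply hs,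
    Matrix.dotProduct_mulVec, ← Matrix.mulVec_transpose, Matrix.transpose_transpose,
    hA.inv_mulVec, normSq]

theorem quadForm_affine (hA : IsRoot A V s) (hs : 0 < s) (D : Matrix (Fin m) (Fin m) ℝ)
    (y : Fin m → ℝ) :
    s⁻¹ * ((affine μ A y - μ) ⬝ᵥ ((V⁻¹ * D * V⁻¹) *ᵥ (affine μ A y - μ))) =
      y ⬝ᵥ ((s • (A⁻¹ * D * (A⁻¹)ᵀ)) *ᵥ y) := by
  have h1 : V⁻¹ * D * V⁻¹ = (s * s) • ((A⁻¹)ᵀ * (A⁻¹ * D * (A⁻¹)ᵀ) * A⁻¹) := by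
    rw [hA.inv_eq hs]
    simp only [Matrix.smul_mul, Matrix.mul_smul, smul_smul, Matrix.mul_assoc]
  rw [affine_sub, h1, Matrix.smul_mulVec, Matrix.smul_mulVec, dotProduct_smul, dotProduct_smul,
    ← Matrix.mulVec_mulVec, hA.inv_mulVec, ← Matrix.mulVec_mulVec, Matrix.dotProduct_mulVec,
    ← Matrix.mulVec_transpose, Matrix.transpose_transpose, hA.inv_mulVec, smul_eq_mul, smul_eq_mul]
  field_simp

theorem trace_inv_mul (hA : IsRoot A V s) (hs : 0 < s) (D : Matrix (Fin m) (Fin m) ℝ) :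
    (V⁻¹ * D).trace = (s • (A⁻¹ * D * (A⁻¹)ᵀ)).trace := by
  rw [hA.inv_eq hs, Matrix.smul_mul, Matrix.trace_smul, Matrix.trace_smul, Matrix.mul_assoc,
    Matrix.trace_mul_comm]

theorem abs_det (hA : IsRoot A V s) (hV : V.PosDef) (hs : 0 < s) :
    |A.det|⁻¹ = s ^ (-((m : ℝ) / 2)) * V.det ^ (-(1 / 2) : ℝ) := by
  have hd := hV.det_pos
  have h1 := congrArg Matrix.det hA.mul_transpose
  rw [Matrix.det_mul, Matrix.det_smul, Matrix.det_transpose, Fintype.card_fin, ← sq,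
    ← sq_abs] at h1
  have h2 : |A.det| = (s ^ m * V.det) ^ (1 / 2 : ℝ) := by
    rw [← Real.sqrt_eq_rpow, ← h1, Real.sqrt_sq (abs_nonneg _)]
  rw [h2, ← Real.rpow_neg (by positivity), Real.mul_rpow (by positivity) hd.le,
    ← Real.rpow_natCast, ← Real.rpow_mul hs.le]
  congr 2
  ring

theorem map_affine_volume (hA : IsRoot A V s) :
    (volume : Measure (Fin m → ℝ)).map (affine μ A) = ENNReal.ofReal |A.det|⁻¹ • volume := by
  have h1 : affine μ A = (fun x => μ + x) ∘ Matrix.toLin' A := by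
    ext y; simp [affine]
  rw [h1, ← Measure.map_map (measurable_const_add μ)
    (LinearMap.continuous_of_finiteDimensional _).measurable,
    Real.map_matrix_volume_pi_eq_smul_volume_pi hA.det_ne_zero, Measure.map_smul,
    (measurePreserving_add_left volume μ).map_eq, abs_inv]

/-- The elliptical distribution is the image of the spherical one. -/
theorem measurePreserving_affine (hA : IsRoot A V s) [NeZero m]
    {S : Matrix (Fin m) (Fin m) ℝ → ℝ} (hS : IsScale S)
    (hV : V.PosDef) (hSV : S V = 1) (hs : 0 < s) (hc : ContinuousOn g (Ioi 0)) :
    MeasurePreserving (affine μ A) (sphLaw m g) (law (pdfC S (gammaOf μ V) s g)) := by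
  have hm : Measurable (affine μ A) := continuous_affine.measurable
  refine ⟨hm, ?_⟩
  set u : (Fin m → ℝ) → ENNReal := fun x => ENNReal.ofReal (g (s⁻¹ * quadInv V (x - μ))) with hu
  have hcomp : u ∘ affine μ A = fun y => ENNReal.ofReal (g (normSq y)) := by
    ext y; simp only [hu, Function.comp_apply, hA.quadInv_affine hs]
  have hae : AEMeasurable u ((volume : Measure (Fin m → ℝ)).map (affine μ A)) := by
    rw [hA.measurableEmbedding.aemeasurable_map_iff, hcomp]
    exact (aemeasurable_ofReal_of_continuousOn hc).comp_measurable measurable_normSq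
  have h := map_withDensity_comp hm hae
  rw [hcomp, hA.map_affine_volume, withDensity_smul_measure,
    ← withDensity_smul' _ _ ENNReal.ofReal_ne_top] at h
  rw [sphLaw, h, law]
  congr 1
  ext x
  have hpos : 0 ≤ |A.det|⁻¹ := by positivity
  rw [Pi.smul_apply, smul_eq_mul, hu, ← ENNReal.ofReal_mul hpos, pdfC_gammaOf hS hV hSV,
    hA.abs_det hV hs]

end IsRoot

end Whitening

/-! ### Quadratic forms of a spherical vector -/

section QuadForms

variable {m : ℕ}

theorem dotProduct_mulVec_eq_sum (B : Matrix (Fin m) (Fin m) ℝ) (y : Fin m → ℝ) :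
    y ⬝ᵥ (B *ᵥ y) = ∑ a, ∑ b, B a b * (y a * y b) := by
  simp only [dotProduct, Matrix.mulVec, Finset.mul_sum]
  exact Finset.sum_congr rfl fun a _ => Finset.sum_congr rfl fun b _ => by ring

theorem mul_dotProduct_mulVec_eq_sum (B : Matrix (Fin m) (Fin m) ℝ) (w : ℝ) (y : Fin m → ℝ) :
    w * (y ⬝ᵥ (B *ᵥ y)) = ∑ a, ∑ b, B a b * (w * (y a * y b)) := by
  rw [dotProduct_mulVec_eq_sum, Finset.mul_sum]
  refine Finset.sum_congr rfl fun a _ => ?_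
  rw [Finset.mul_sum]
  exact Finset.sum_congr rfl fun b _ => by ring

variable {ν : Measure (Fin m → ℝ)} {W : (Fin m → ℝ) → ℝ}

theorem Spherical.integral_quadForm (hν : Spherical ν) (hW : Radial W)
    (hi : ∀ a b, Integrable (fun y => W y * (y a * y b)) ν) (B : Matrix (Fin m) (Fin m) ℝ) :
    ∫ y, W y * (y ⬝ᵥ (B *ᵥ y)) ∂ν = B.trace * ((∫ y, W y * normSq y ∂ν) / m) := by
  simp only [mul_dotProduct_mulVec_eq_sum]
  have hi' : ∀ a b, Integrable (fun y => B a b * (W y * (y a * y b))) ν :=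
    fun a b => (hi a b).const_mul _
  rw [integral_finsetSum _ fun a _ => integrable_finsetSum _ fun b _ => hi' a b,
    Matrix.trace, Finset.sum_mul]
  refine Finset.sum_congr rfl fun a _ => ?_
  rw [integral_finsetSum _ fun b _ => hi' a b]
  simp only [integral_const_mul, hν.integral_mul_mul hW hi]
  simp

theorem Spherical.integral_linear_mul_linear (hν : Spherical ν) (hW : Radial W)
    (hi : ∀ a b, Integrable (fun y => W y * (y a * y b)) ν) (u v : Fin m → ℝ) :
    ∫ y, W y * ((u ⬝ᵥ y) * (v ⬝ᵥ y)) ∂ν = (u ⬝ᵥ v) * ((∫ y, W y * normSq y ∂ν) / m) := by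
  have h := hν.integral_quadForm hW hi (Matrix.vecMulVec u v)
  rw [Matrix.trace_vecMulVec] at h
  rw [← h]
  congr 1
  ext y
  rw [Matrix.vecMulVec_mulVec]
  simp [dotProduct_smul, dotProduct_comm y u, mul_comm]

/-- The covariance of quadratic forms: `E{W (yᵀBy) (yᵀDy)}` for a radial weight `W`. -/
theorem Spherical.integral_quadForm_mul_quadForm (hν : Spherical ν) (hW : Radial W)
    (hi : ∀ a b c d, Integrable (fun y => W y * (y a * y b * (y c * y d))) ν)
    (B D : Matrix (Fin m) (Fin m) ℝ) :
    ∫ y, W y * ((y ⬝ᵥ (B *ᵥ y)) * (y ⬝ᵥ (D *ᵥ y))) ∂ν =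
      (B.trace * D.trace + (B * Dᵀ).trace + (B * D).trace) *
        ((∫ y, W y * normSq y ^ 2 ∂ν) / ((m : ℝ) * (m + 2))) := by
  have h : ∀ y, W y * ((y ⬝ᵥ (B *ᵥ y)) * (y ⬝ᵥ (D *ᵥ y))) =
      ∑ a, ∑ b, ∑ c, ∑ d, B a b * D c d * (W y * (y a * y b * (y c * y d))) := fun y => by
    rw [dotProduct_mulVec_eq_sum, dotProduct_mulVec_eq_sum, Finset.sum_mul, Finset.mul_sum]
    refine Finset.sum_congr rfl fun a _ => ?_
    rw [Finset.sum_mul, Finset.mul_sum]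
    refine Finset.sum_congr rfl fun b _ => ?_
    rw [Finset.mul_sum, Finset.mul_sum]
    refine Finset.sum_congr rfl fun c _ => ?_
    rw [Finset.mul_sum, Finset.mul_sum]
    exact Finset.sum_congr rfl fun d _ => by ring
  simp only [h]
  have hi' : ∀ a b c d, Integrable
      (fun y => B a b * D c d * (W y * (y a * y b * (y c * y d)))) ν :=
    fun a b c d => (hi a b c d).const_mul _
  have hsum : ∀ τ : ℝ, (B.trace * D.trace + (B * Dᵀ).trace + (B * D).trace) * τ =
      ∑ a, ∑ b, ∑ c, ∑ d, B a b * D c d * (((if a = b ∧ c = d then 1 else 0) +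
        (if a = c ∧ b = d then 1 else 0) + (if a = d ∧ b = c then 1 else 0)) * τ) := by
    intro τ
    simp only [← mul_assoc, ← Finset.sum_mul, mul_add, Finset.sum_add_distrib, mul_ite, mul_one,
      mul_zero, ite_and]
    congr 2
    · congr 1
      · simp [Matrix.trace, Finset.sum_mul_sum]
      · simp [Matrix.trace, Matrix.mul_apply]
    · simp [Matrix.trace, Matrix.mul_apply]
  rw [hsum, integral_finsetSum _ fun a _ => integrable_finsetSum _ fun b _ =>
    integrable_finsetSum _ fun c _ => integrable_finsetSum _ fun d _ => hi' a b c d]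
  refine Finset.sum_congr rfl fun a _ => ?_
  rw [integral_finsetSum _ fun b _ =>
    integrable_finsetSum _ fun c _ => integrable_finsetSum _ fun d _ => hi' a b c d]
  refine Finset.sum_congr rfl fun b _ => ?_
  rw [integral_finsetSum _ fun c _ => integrable_finsetSum _ fun d _ => hi' a b c d]
  refine Finset.sum_congr rfl fun c _ => ?_
  rw [integral_finsetSum _ fun d _ => hi' a b c d]
  refine Finset.sum_congr rfl fun d _ => ?_
  rw [integral_const_mul, hν.integral_quartic hW hi]

end QuadForms

/-! ### The standardized efficient score -/

section Residual

/-- Density generators with a continuous derivative and finite `α` and `β`. -/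
structure RegularGen (m : ℕ) (g : ℝ → ℝ) : Prop where
  mem : g ∈ Gen m
  contDiffOn : ContDiffOn ℝ 1 g (Ioi 0)
  integrable_alpha : Integrable (fun q : ℝ => q ^ 2 * phi g q ^ 2) (modularLaw m g)
  integrable_beta : Integrable (fun q : ℝ => q * phi g q ^ 2) (modularLaw m g)

variable {m : ℕ} {g : ℝ → ℝ}

/-- The radial weight `φ (‖y‖²)` of the scores. -/
def weight (g : ℝ → ℝ) (y : Fin m → ℝ) : ℝ := phi g (normSq y)

theorem radial_weight : Radial (weight (m := m) g) := fun y y' h => by simp only [weight, h]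

theorem Radial.mul {W W' : (Fin m → ℝ) → ℝ} (h : Radial W) (h' : Radial W') :
    Radial fun y => W y * W' y := fun y y' hy => by simp only [h y y' hy, h' y y' hy]

namespace RegularGen

theorem continuousOn (h : RegularGen m g) : ContinuousOn g (Ioi 0) := h.contDiffOn.continuousOn

variable [NeZero m]

theorem isProbabilityMeasure (h : RegularGen m g) : IsProbabilityMeasure (sphLaw m g) := by
  have := isProbabilityMeasure_modularLaw h.mem
  have h1 := (measurePreserving_normSq (m := m) h.continuousOn).measure_preimage
    MeasurableSet.univ.nullMeasurableSet
  exact ⟨by simpa using h1⟩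

theorem ae_pos (h : RegularGen m g) : ∀ᵐ y ∂sphLaw m g, 0 < normSq y ∧ 0 < g (normSq y) := by
  have hmp := measurePreserving_normSq (m := m) h.continuousOn
  exact hmp.quasiMeasurePreserving.ae (p := fun q => 0 < q ∧ 0 < g q)
    (ae_modularLaw_pos h.mem h.continuousOn)

theorem aestronglyMeasurable_weight (h : RegularGen m g) :
    AEStronglyMeasurable (weight (m := m) g) (sphLaw m g) :=
  (aestronglyMeasurable_phi h.continuousOn).comp_measurePreserving
    (measurePreserving_normSq h.continuousOn)

theorem memLp_linear (h : RegularGen m g) (a : Fin m) :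
    MemLp (fun y => weight g y * y a) 2 (sphLaw m g) := by
  have hmeas : AEStronglyMeasurable (fun y : Fin m → ℝ => weight g y * y a) (sphLaw m g) :=
    h.aestronglyMeasurable_weight.mul (measurable_pi_apply a).aestronglyMeasurable
  rw [memLp_two_iff_integrable_sq hmeas]
  have hint := (measurePreserving_normSq (m := m) h.continuousOn).integrable_comp_of_integrable
    h.integrable_beta
  refine hint.mono' (hmeas.pow 2) (.of_forall fun y => ?_)
  rw [Real.norm_of_nonneg (sq_nonneg _), mul_pow, Function.comp_apply, mul_comm]
  exact mul_le_mul_of_nonneg_right (sq_le_normSq y a) (sq_nonneg _)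

theorem memLp_quadratic (h : RegularGen m g) (a b : Fin m) :
    MemLp (fun y => weight g y * (y a * y b)) 2 (sphLaw m g) := by
  have hmeas : AEStronglyMeasurable (fun y : Fin m → ℝ => weight g y * (y a * y b))
      (sphLaw m g) :=
    h.aestronglyMeasurable_weight.mul
      ((measurable_pi_apply a).mul (measurable_pi_apply b)).aestronglyMeasurable
  rw [memLp_two_iff_integrable_sq hmeas]
  have hint := (measurePreserving_normSq (m := m) h.continuousOn).integrable_comp_of_integrable
    h.integrable_alpha
  refine hint.mono' (hmeas.pow 2) (.of_forall fun y => ?_)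
  rw [Real.norm_of_nonneg (sq_nonneg _), mul_pow, mul_pow, Function.comp_apply, mul_comm,
    sq (normSq y)]
  exact mul_le_mul_of_nonneg_right (mul_le_mul (sq_le_normSq y a) (sq_le_normSq y b)
    (sq_nonneg _) (normSq_nonneg y)) (sq_nonneg _)

theorem integrable_weight_sq (h : RegularGen m g) (a b : Fin m) :
    Integrable (fun y => weight g y ^ 2 * (y a * y b)) (sphLaw m g) :=
  ((h.memLp_linear a).integrable_mul (h.memLp_linear b)).congr
    (.of_forall fun y => by simp only [Pi.mul_apply]; ring)

theorem integrable_weight_sq_quartic (h : RegularGen m g) (a b c d : Fin m) :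
    Integrable (fun y => weight g y ^ 2 * (y a * y b * (y c * y d))) (sphLaw m g) :=
  ((h.memLp_quadratic a b).integrable_mul (h.memLp_quadratic c d)).congr
    (.of_forall fun y => by simp only [Pi.mul_apply]; ring)

theorem integral_comp_normSq (h : RegularGen m g) {f : ℝ → ℝ}
    (hf : AEStronglyMeasurable f (modularLaw m g)) :
    ∫ y, f (normSq y) ∂sphLaw m g = ∫ q, f q ∂modularLaw m g := by
  have hmp := measurePreserving_normSq (m := m) h.continuousOn
  rw [← hmp.map_eq] at hf ⊢
  exact (integral_map measurable_normSq.aemeasurable hf).symm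

theorem integral_weight_sq (h : RegularGen m g) :
    (∫ y, weight g y ^ 2 * normSq y ∂sphLaw m g) / m = beta m g := by
  rw [beta, ← h.integral_comp_normSq h.integrable_beta.1]
  simp only [weight, mul_comm]

theorem integral_weight_sq_quartic (h : RegularGen m g) :
    (∫ y, weight g y ^ 2 * normSq y ^ 2 ∂sphLaw m g) / ((m : ℝ) * (m + 2)) = alpha m g := by
  rw [alpha, ← h.integral_comp_normSq h.integrable_alpha.1]
  simp only [weight, mul_comm]

end RegularGen

/-- The traceless part of a matrix. -/
def traceless (B : Matrix (Fin m) (Fin m) ℝ) : Matrix (Fin m) (Fin m) ℝ :=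
  B - (B.trace / m) • (1 : Matrix (Fin m) (Fin m) ℝ)

theorem dotProduct_traceless (B : Matrix (Fin m) (Fin m) ℝ) (y : Fin m → ℝ) :
    y ⬝ᵥ (traceless B *ᵥ y) = y ⬝ᵥ (B *ᵥ y) - B.trace / m * normSq y := by
  simp [traceless, Matrix.sub_mulVec, Matrix.smul_mulVec, normSq]

theorem traceless_isSymm {B : Matrix (Fin m) (Fin m) ℝ} (hB : B.IsSymm) : (traceless B).IsSymm := by
  rw [Matrix.IsSymm, traceless, Matrix.transpose_sub, Matrix.transpose_smul,
    Matrix.transpose_one, hB.eq]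

variable [NeZero m]

theorem trace_traceless (B : Matrix (Fin m) (Fin m) ℝ) : (traceless B).trace = 0 := by
  have hm : (m : ℝ) ≠ 0 := Nat.cast_ne_zero.2 (NeZero.ne m)
  simp [traceless, Matrix.trace_sub, hm]

theorem trace_traceless_mul (B D : Matrix (Fin m) (Fin m) ℝ) :
    (traceless B * traceless D).trace = (B * D).trace - (m : ℝ)⁻¹ * (B.trace * D.trace) := by
  have hm : (m : ℝ) ≠ 0 := Nat.cast_ne_zero.2 (NeZero.ne m)
  simp [traceless, Matrix.sub_mul, Matrix.mul_sub, Matrix.trace_sub]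
  field_simp

/-- The efficient score in standardized coordinates: location components `φ (C y)_i` and shape
components `½ φ yᵀ B y` with the traceless part of `B_k`. -/
def stdEff (g : ℝ → ℝ) (C : Matrix (Fin m) (Fin m) ℝ) (B : OffIdx m → Matrix (Fin m) (Fin m) ℝ) :
    GammaIdx m → (Fin m → ℝ) → ℝ :=
  Sum.elim (fun i y => weight g y * (C i ⬝ᵥ y))
    (fun k y => 1 / 2 * (weight g y * (y ⬝ᵥ (traceless (B k) *ᵥ y))))

variable {C : Matrix (Fin m) (Fin m) ℝ} {B : OffIdx m → Matrix (Fin m) (Fin m) ℝ}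

theorem RegularGen.memLp_linearForm (h : RegularGen m g) (u : Fin m → ℝ) :
    MemLp (fun y => weight g y * (u ⬝ᵥ y)) 2 (sphLaw m g) := by
  have h1 : ∀ y : Fin m → ℝ, weight g y * (u ⬝ᵥ y) = ∑ a, u a * (weight g y * y a) := fun y => by
    rw [dotProduct, Finset.mul_sum]
    exact Finset.sum_congr rfl fun a _ => by ring
  simp only [h1]
  exact memLp_finsetSum _ fun a _ => (h.memLp_linear a).const_mul _

theorem RegularGen.memLp_quadForm (h : RegularGen m g) (D : Matrix (Fin m) (Fin m) ℝ) :
    MemLp (fun y => weight g y * (y ⬝ᵥ (D *ᵥ y))) 2 (sphLaw m g) := by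
  simp only [mul_dotProduct_mulVec_eq_sum]
  exact memLp_finsetSum _ fun a _ => memLp_finsetSum _ fun b _ =>
    (h.memLp_quadratic a b).const_mul _

theorem memLp_stdEff (h : RegularGen m g) (i : GammaIdx m) :
    MemLp (stdEff g C B i) 2 (sphLaw m g) := by
  rcases i with i | k
  · exact h.memLp_linearForm (C i)
  · exact (h.memLp_quadForm (traceless (B k))).const_mul _

/-- The standardized efficient score is orthogonal to every square-integrable function of the
squared norm. -/
theorem integral_stdEff_mul_radial (h : RegularGen m g) {ψ : (Fin m → ℝ) → ℝ} (hψ : Radial ψ)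
    (hψ2 : MemLp ψ 2 (sphLaw m g)) (i : GammaIdx m) :
    ∫ y, stdEff g C B i y * ψ y ∂sphLaw m g = 0 := by
  have hν := spherical_sphLaw (m := m) h.continuousOn
  rcases i with i | k
  · refine hν.integral_odd fun y => ?_
    have hn : normSq (-y) = normSq y := by simp [normSq]
    simp [stdEff, radial_weight _ _ hn, hψ _ _ hn]
  · have h1 : ∀ y, stdEff g C B (Sum.inr k) y * ψ y =
        1 / 2 * ((weight g y * ψ y) * (y ⬝ᵥ (traceless (B k) *ᵥ y))) := fun y => by
      simp only [stdEff, Sum.elim_inr]; ring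
    simp only [h1]
    rw [integral_const_mul, hν.integral_quadForm (radial_weight.mul hψ) _ (traceless (B k)),
      trace_traceless, zero_mul, mul_zero]
    intro a b
    exact ((h.memLp_quadratic a b).integrable_mul hψ2).congr
      (.of_forall fun y => by simp only [Pi.mul_apply]; ring)

/-- The covariance matrix of the standardized efficient score. -/
theorem integral_stdEff_mul_stdEff (h : RegularGen m g) (hB : ∀ k, (B k).IsSymm)
    (i j : GammaIdx m) :
    ∫ y, stdEff g C B i y * stdEff g C B j y ∂sphLaw m g =
      Matrix.fromBlocks (beta m g • (C * Cᵀ)) 0 0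
        (Matrix.of fun k l => 2⁻¹ * alpha m g *
          ((B k * B l).trace - (m : ℝ)⁻¹ * ((B k).trace * (B l).trace))) i j := by
  have hν := spherical_sphLaw (m := m) h.continuousOn
  have hW : Radial fun y : Fin m → ℝ => weight g y ^ 2 := fun y y' hy => by
    simp only [radial_weight y y' hy]
  rcases i with i | k <;> rcases j with j | l
  · have h1 : ∀ y, stdEff g C B (Sum.inl i) y * stdEff g C B (Sum.inl j) y =
        weight g y ^ 2 * ((C i ⬝ᵥ y) * (C j ⬝ᵥ y)) := fun y => by
      simp only [stdEff, Sum.elim_inl]; ring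
    simp only [h1]
    rw [hν.integral_linear_mul_linear hW h.integrable_weight_sq, h.integral_weight_sq,
      Matrix.fromBlocks_apply₁₁, Matrix.smul_apply, Matrix.mul_apply', smul_eq_mul, mul_comm]
    rfl
  · rw [Matrix.fromBlocks_apply₁₂, Matrix.zero_apply]
    refine hν.integral_odd fun y => ?_
    have hn : normSq (-y) = normSq y := by simp [normSq]
    simp [stdEff, radial_weight _ _ hn, Matrix.mulVec_neg]
  · rw [Matrix.fromBlocks_apply₂₁, Matrix.zero_apply]
    refine hν.integral_odd fun y => ?_
    have hn : normSq (-y) = normSq y := by simp [normSq]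
    simp [stdEff, radial_weight _ _ hn, Matrix.mulVec_neg]
  · have h1 : ∀ y, stdEff g C B (Sum.inr k) y * stdEff g C B (Sum.inr l) y =
        1 / 4 * (weight g y ^ 2 *
          ((y ⬝ᵥ (traceless (B k) *ᵥ y)) * (y ⬝ᵥ (traceless (B l) *ᵥ y)))) := fun y => by
      simp only [stdEff, Sum.elim_inr]; ring
    simp only [h1]
    rw [integral_const_mul, hν.integral_quadForm_mul_quadForm hW h.integrable_weight_sq_quartic,
      h.integral_weight_sq_quartic, (traceless_isSymm (hB l)).eq, trace_traceless,
      trace_traceless_mul, Matrix.fromBlocks_apply₂₂, Matrix.of_apply]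
    ring

end Residual

/-! ### Projections in `L²` -/

section Hilbert

variable {m : ℕ} {P : Measure (Fin m → ℝ)}

theorem toL2_eq {f : (Fin m → ℝ) → ℝ} (hf : MemLp f 2 P) : toL2 P f = hf.toLp f := dif_pos hf

/-- The closed subspace of `L²` orthogonal to a given square-integrable function. -/
def orthTo {e : (Fin m → ℝ) → ℝ} (he : MemLp e 2 P) : Submodule ℝ (Lp ℝ 2 P) :=
  (Submodule.span ℝ {he.toLp e})ᗮ

theorem isClosed_orthTo {e : (Fin m → ℝ) → ℝ} (he : MemLp e 2 P) :
    IsClosed (orthTo he : Set (Lp ℝ 2 P)) :=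
  Submodule.isClosed_orthogonal _

theorem inner_toLp {e : (Fin m → ℝ) → ℝ} (he : MemLp e 2 P) (w : Lp ℝ 2 P) :
    inner ℝ (he.toLp e) w = ∫ x, e x * w x ∂P := by
  rw [L2.inner_def]
  refine integral_congr_ae ?_
  filter_upwards [he.coeFn_toLp] with x hx
  simp [hx, mul_comm]

theorem mem_orthTo {e : (Fin m → ℝ) → ℝ} (he : MemLp e 2 P) {w : Lp ℝ 2 P} :
    w ∈ orthTo he ↔ ∫ x, e x * w x ∂P = 0 := by
  rw [orthTo, Submodule.mem_orthogonal_singleton_iff_inner_right, inner_toLp]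

/-- The efficient information when the projection of the score `sc i` on the nuisance tangent space
is the multiple `R i` of one function `ρ`. -/
theorem effInfo_apply {ι : Type} {sc : ι → (Fin m → ℝ) → ℝ} {ρ : (Fin m → ℝ) → ℝ} {R : ι → ℝ}
    {T : Submodule ℝ (Lp ℝ 2 P)} (hsc : ∀ i, MemLp (sc i) 2 P) (hρ : MemLp ρ 2 P)
    (he : ∀ i, MemLp (fun x => sc i x - R i * ρ x) 2 P)
    (hmem : toL2 P ρ ∈ T.topologicalClosure) (horth : ∀ i, T ≤ orthTo (he i)) (i j : ι) :
    effInfo sc T i j = ∫ x, (sc i x - R i * ρ x) * (sc j x - R j * ρ x) ∂P := by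
  have key : ∀ i, effScore T (toL2 P (sc i)) = (he i).toLp _ := by
    intro i
    have hdiff : (he i).toLp _ = toL2 P (sc i) - R i • toL2 P ρ := by
      rw [toL2_eq (hsc i), toL2_eq hρ, ← MemLp.toLp_const_smul, ← MemLp.toLp_sub]
      rfl
    rw [effScore, Submodule.eq_starProjection_of_mem_of_inner_eq_zero
      (v := R i • toL2 P ρ) (Submodule.smul_mem _ _ hmem), hdiff]
    intro w hw
    have hw2 := Submodule.topologicalClosure_minimal T (horth i) (isClosed_orthTo (he i)) hw
    rw [← hdiff, inner_toLp]
    exact (mem_orthTo (he i)).1 hw2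
  simp only [effInfo, Matrix.of_apply, key]
  refine integral_congr_ae ?_
  filter_upwards [(he i).coeFn_toLp, (he j).coeFn_toLp] with x hx hx'
  rw [hx, hx']

theorem score_mem_paramTangent {ι : Type} [DecidableEq ι] (p : (ι → ℝ) → (Fin m → ℝ) → ℝ)
    (θ₀ : ι → ℝ) (i : ι) : toL2 (law (p θ₀)) (score p θ₀ i) ∈ paramTangent p θ₀ :=
  Submodule.subset_span ⟨i, rfl⟩

end Hilbert

/-! ### Scores and tangent spaces at an elliptical distribution -/

section Tangent

variable {m : ℕ} [NeZero m] {S : Matrix (Fin m) (Fin m) ℝ → ℝ} {μ : Fin m → ℝ}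
  {V A : Matrix (Fin m) (Fin m) ℝ} {s : ℝ} {g : ℝ → ℝ}

/-- The assumptions on the true parameter, with a chosen root `A` of `s V`. -/
structure IsTrueParam (S : Matrix (Fin m) (Fin m) ℝ → ℝ) (V A : Matrix (Fin m) (Fin m) ℝ) (s : ℝ)
    (g : ℝ → ℝ) : Prop where
  isScale : IsScale S
  posDef : V.PosDef
  shape : S V = 1
  pos : 0 < s
  root : IsRoot A V s
  gen : RegularGen m g

/-- The derivatives of the shape matrix in standardized coordinates. -/
def stdDeriv (S : Matrix (Fin m) (Fin m) ℝ → ℝ) (V A : Matrix (Fin m) (Fin m) ℝ) (s : ℝ)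
    (k : OffIdx m) : Matrix (Fin m) (Fin m) ℝ :=
  s • (A⁻¹ * shapeDeriv S V k * (A⁻¹)ᵀ)

/-- The coefficients of the scores on the score of the scale. -/
def scaleCoeff (S : Matrix (Fin m) (Fin m) ℝ → ℝ) (V A : Matrix (Fin m) (Fin m) ℝ) (s : ℝ) :
    GammaIdx m → ℝ :=
  Sum.elim 0 fun k => s * ((stdDeriv S V A s k).trace / m)

/-- The scores of `γ` minus their projections on the score of the scale. -/
def residual (S : Matrix (Fin m) (Fin m) ℝ → ℝ) (μ : Fin m → ℝ) (V A : Matrix (Fin m) (Fin m) ℝ)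
    (s : ℝ) (g : ℝ → ℝ) (i : GammaIdx m) (x : Fin m → ℝ) : ℝ :=
  scoreC S (gammaOf μ V) s g i x - scaleCoeff S V A s i * scoreS S (gammaOf μ V) s g x

/-- The argument `s⁻¹ (x - μ)ᵀ V⁻¹ (x - μ)` of the generator. -/
def stdSq (μ : Fin m → ℝ) (V : Matrix (Fin m) (Fin m) ℝ) (s : ℝ) (x : Fin m → ℝ) : ℝ :=
  s⁻¹ * quadInv V (x - μ)

theorem measurable_stdSq {m : ℕ} {μ : Fin m → ℝ} {V : Matrix (Fin m) (Fin m) ℝ} {s : ℝ} :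
    Measurable (stdSq μ V s) := by
  have : Continuous (stdSq μ V s) := by
    unfold stdSq quadInv; fun_prop
  exact this.measurable

namespace IsTrueParam

theorem measurePreserving (h : IsTrueParam S V A s g) :
    MeasurePreserving (affine μ A) (sphLaw m g) (law (pdfC S (gammaOf μ V) s g)) :=
  h.root.measurePreserving_affine h.isScale h.posDef h.shape h.pos h.gen.continuousOn

theorem isProbabilityMeasure (h : IsTrueParam S V A s g) :
    IsProbabilityMeasure (law (pdfC S (gammaOf μ V) s g)) := by
  have := h.gen.isProbabilityMeasure
  have h1 := (h.measurePreserving (μ := μ)).measure_preimage MeasurableSet.univ.nullMeasurableSet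
  exact ⟨by simpa using h1.symm⟩

theorem integral_comp (h : IsTrueParam S V A s g) (f : (Fin m → ℝ) → ℝ) :
    ∫ y, f (affine μ A y) ∂sphLaw m g = ∫ x, f x ∂law (pdfC S (gammaOf μ V) s g) :=
  h.measurePreserving.integral_comp h.root.measurableEmbedding f

theorem memLp_iff (h : IsTrueParam S V A s g) (f : (Fin m → ℝ) → ℝ) :
    MemLp f 2 (law (pdfC S (gammaOf μ V) s g)) ↔ MemLp (f ∘ affine μ A) 2 (sphLaw m g) := by
  rw [← (h.measurePreserving (μ := μ)).map_eq]
  exact h.root.measurableEmbedding.memLp_map_measure_iff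

theorem stdSq_affine (h : IsTrueParam S V A s g) (y : Fin m → ℝ) :
    stdSq μ V s (affine μ A y) = normSq y := h.root.quadInv_affine h.pos y

theorem differentiableAt (h : IsTrueParam S V A s g) {q : ℝ} (hq : 0 < q) :
    DifferentiableAt ℝ g q :=
  (h.gen.contDiffOn.differentiableOn one_ne_zero).differentiableAt (Ioi_mem_nhds hq)

theorem measurePreserving_stdSq (h : IsTrueParam S V A s g) :
    MeasurePreserving (stdSq μ V s) (law (pdfC S (gammaOf μ V) s g)) (modularLaw m g) := by
  refine ⟨measurable_stdSq, ?_⟩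
  have h1 : stdSq μ V s ∘ affine μ A = normSq := funext h.stdSq_affine
  rw [← (h.measurePreserving (μ := μ)).map_eq,
    Measure.map_map measurable_stdSq continuous_affine.measurable, h1,
    (measurePreserving_normSq h.gen.continuousOn).map_eq]

theorem ae_stdSq (h : IsTrueParam S V A s g) :
    ∀ᵐ x ∂law (pdfC S (gammaOf μ V) s g), 0 < stdSq μ V s x ∧ 0 < g (stdSq μ V s x) :=
  (h.measurePreserving_stdSq (μ := μ)).quasiMeasurePreserving.ae (p := fun q => 0 < q ∧ 0 < g q)
    (ae_modularLaw_pos h.gen.mem h.gen.continuousOn)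

theorem scoreS_ae (h : IsTrueParam S V A s g) :
    scoreS S (gammaOf μ V) s g =ᵐ[law (pdfC S (gammaOf μ V) s g)]
      fun x => (2 * s)⁻¹ * (stdSq μ V s x * phi g (stdSq μ V s x) - m) := by
  filter_upwards [h.ae_stdSq (μ := μ)] with x hx
  exact score_scale h.isScale h.posDef h.shape h.pos (h.differentiableAt hx.1) hx.2.ne'

theorem scoreS_affine_ae (h : IsTrueParam S V A s g) :
    scoreS S (gammaOf μ V) s g ∘ affine μ A =ᵐ[sphLaw m g]
      fun y => (2 * s)⁻¹ * (normSq y * phi g (normSq y) - m) := by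
  have h1 := (h.measurePreserving (μ := μ)).quasiMeasurePreserving.ae h.scoreS_ae
  filter_upwards [h1] with y hy
  rw [Function.comp_apply, hy, h.stdSq_affine]

/-- The residual scores depend on the data through the standardized efficient score. -/
theorem residual_affine_ae (h : IsTrueParam S V A s g) (i : GammaIdx m) :
    residual S μ V A s g i ∘ affine μ A =ᵐ[sphLaw m g]
      stdEff g (A⁻¹)ᵀ (stdDeriv S V A s) i := by
  filter_upwards [h.gen.ae_pos, h.scoreS_affine_ae (μ := μ)] with y hy hs
  have hq : s⁻¹ * quadInv V (affine μ A y - μ) = normSq y := h.stdSq_affine y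
  have hd : DifferentiableAt ℝ g (s⁻¹ * quadInv V (affine μ A y - μ)) := by
    rw [hq]; exact h.differentiableAt hy.1
  have hg0 : g (s⁻¹ * quadInv V (affine μ A y - μ)) ≠ 0 := by
    rw [hq]; exact hy.2.ne'
  have hs' : scoreS S (gammaOf μ V) s g (affine μ A y) =
    (2 * s)⁻¹ * (normSq y * phi g (normSq y) - m) := hs
  have hm : (m : ℝ) ≠ 0 := Nat.cast_ne_zero.2 (NeZero.ne m)
  have hpos := h.pos
  rcases i with i | k
  · have hC := congrFun (h.root.inv_mulVec_apply h.pos y) i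
    rw [Pi.smul_apply, smul_eq_mul] at hC
    simp only [Function.comp_apply, residual, scaleCoeff, Sum.elim_inl, Pi.zero_apply, zero_mul,
      sub_zero, stdEff]
    rw [score_location h.isScale h.posDef h.shape h.pos hd hg0, hq, affine_sub, hC]
    rfl
  · simp only [Function.comp_apply, residual, scaleCoeff, Sum.elim_inr, stdEff]
    rw [score_shape h.isScale h.posDef h.shape h.pos hd hg0, hq, h.root.quadForm_affine h.pos,
      h.root.trace_inv_mul h.pos, hs', dotProduct_traceless, weight, stdDeriv]
    field_simp
    ring

theorem memLp_scoreS (h : IsTrueParam S V A s g) :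
    MemLp (scoreS S (gammaOf μ V) s g) 2 (law (pdfC S (gammaOf μ V) s g)) := by
  have := isProbabilityMeasure_modularLaw h.gen.mem
  have h1 : MemLp (fun q => (2 * s)⁻¹ * (q * phi g q - m)) 2 (modularLaw m g) :=
    ((memLp_mul_phi h.gen.continuousOn h.gen.integrable_alpha).sub (memLp_const (m : ℝ))).const_mul _
  exact (h1.comp_measurePreserving h.measurePreserving_stdSq).ae_eq h.scoreS_ae.symm

theorem memLp_residual (h : IsTrueParam S V A s g) (i : GammaIdx m) :
    MemLp (residual S μ V A s g i) 2 (law (pdfC S (gammaOf μ V) s g)) :=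
  (h.memLp_iff _).2 ((memLp_stdEff h.gen i).ae_eq (h.residual_affine_ae i).symm)

theorem memLp_scoreC (h : IsTrueParam S V A s g) (i : GammaIdx m) :
    MemLp (scoreC S (gammaOf μ V) s g i) 2 (law (pdfC S (gammaOf μ V) s g)) := by
  have h1 := (h.memLp_residual (μ := μ) i).add (h.memLp_scoreS.const_mul (scaleCoeff S V A s i))
  refine h1.ae_eq (.of_forall fun x => ?_)
  simp [residual]

theorem integral_modular_score (h : IsTrueParam S V A s g) :
    ∫ q, (2 * s)⁻¹ * (q * phi g q - m) ∂modularLaw m g = 0 := by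
  have := isProbabilityMeasure_modularLaw h.gen.mem
  have hi : Integrable (fun q => q * phi g q) (modularLaw m g) :=
    (memLp_mul_phi h.gen.continuousOn h.gen.integrable_alpha).integrable one_le_two
  rw [integral_const_mul, integral_sub hi (integrable_const _),
    integral_mul_phi h.gen.mem h.gen.contDiffOn h.gen.integrable_alpha]
  simp

theorem integral_scoreS (h : IsTrueParam S V A s g) :
    ∫ x, scoreS S (gammaOf μ V) s g x ∂law (pdfC S (gammaOf μ V) s g) = 0 := by
  have := isProbabilityMeasure_modularLaw h.gen.mem
  have h1 : AEStronglyMeasurable (fun q => (2 * s)⁻¹ * (q * phi g q - m)) (modularLaw m g) :=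
    (((memLp_mul_phi h.gen.continuousOn h.gen.integrable_alpha).sub
      (memLp_const (m : ℝ))).const_mul _).1
  have hmp := h.measurePreserving_stdSq (μ := μ)
  rw [integral_congr_ae h.scoreS_ae, ← h.integral_modular_score]
  rw [← hmp.map_eq] at h1 ⊢
  exact (integral_map measurable_stdSq.aemeasurable h1).symm

/-- The residuals are orthogonal to the square-integrable functions of the squared norm of the
standardized observation. -/
theorem integral_residual_mul (h : IsTrueParam S V A s g) (i : GammaIdx m)
    {w ψ : (Fin m → ℝ) → ℝ} (hw : MemLp w 2 (law (pdfC S (gammaOf μ V) s g))) (hψ : Radial ψ)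
    (hwψ : w ∘ affine μ A =ᵐ[sphLaw m g] ψ) :
    ∫ x, residual S μ V A s g i x * w x ∂law (pdfC S (gammaOf μ V) s g) = 0 := by
  have hψ2 : MemLp ψ 2 (sphLaw m g) := ((h.memLp_iff w).1 hw).ae_eq hwψ
  rw [← h.integral_comp, ← integral_stdEff_mul_radial h.gen hψ hψ2 i (C := (A⁻¹)ᵀ)
    (B := stdDeriv S V A s)]
  refine integral_congr_ae ?_
  filter_upwards [hwψ, h.residual_affine_ae (μ := μ) i] with y h1 h2
  simp only [Function.comp_apply] at h1 h2
  rw [h1, h2]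

theorem integral_scoreC (h : IsTrueParam S V A s g) (i : GammaIdx m) :
    ∫ x, scoreC S (gammaOf μ V) s g i x ∂law (pdfC S (gammaOf μ V) s g) = 0 := by
  have := h.isProbabilityMeasure (μ := μ)
  have h1 := h.integral_residual_mul (μ := μ) i (w := fun _ => 1) (ψ := fun _ => 1) (memLp_const 1)
    (fun _ _ _ => rfl) (.of_forall fun _ => rfl)
  simp only [mul_one] at h1
  have hr := (h.memLp_residual (μ := μ) i).integrable one_le_two
  have hS := (h.memLp_scoreS (μ := μ)).integrable one_le_two
  have h2 : ∀ x, scoreC S (gammaOf μ V) s g i x = residual S μ V A s g i x +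
      scaleCoeff S V A s i * scoreS S (gammaOf μ V) s g x := fun x => by simp [residual]
  simp only [h2]
  rw [integral_add hr (hS.const_mul _), h1, integral_const_mul, h.integral_scoreS]
  simp

theorem tangentS_le (h : IsTrueParam S V A s g) (i : GammaIdx m) :
    tangentS S (gammaOf μ V) s g ≤ orthTo (h.memLp_residual (μ := μ) i) := by
  refine Submodule.span_le.2 ?_
  rintro _ ⟨⟨⟩, rfl⟩
  refine (mem_orthTo (h.memLp_residual (μ := μ) i)).2 ?_
  have h2 : toL2 (law (pdfC S (gammaOf μ V) s g)) (scoreS S (gammaOf μ V) s g) =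
      (h.memLp_scoreS (μ := μ)).toLp _ := toL2_eq _
  change ∫ x, _ * (toL2 (law (pdfC S (gammaOf μ V) s g)) (scoreS S (gammaOf μ V) s g)) x
    ∂law (pdfC S (gammaOf μ V) s g) = 0
  rw [h2]
  refine h.integral_residual_mul i (Lp.memLp _)
    (ψ := fun y => (2 * s)⁻¹ * (normSq y * phi g (normSq y) - m)) (fun y y' hy => by simp only [hy])
    ?_
  have h3 := (h.measurePreserving (μ := μ)).quasiMeasurePreserving.ae
    (h.memLp_scoreS (μ := μ)).coeFn_toLp
  filter_upwards [h3, h.scoreS_affine_ae (μ := μ)] with y h4 h5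
  rw [Function.comp_apply, h4]
  exact h5

theorem scoreS_mem_tangentS :
    toL2 (law (pdfC S (gammaOf μ V) s g)) (scoreS S (gammaOf μ V) s g) ∈
      tangentS S (gammaOf μ V) s g :=
  score_mem_paramTangent (scaleModel S (gammaOf μ V) g) (fun _ => s) ()

/-- When the densities of a model are functions of `(x - μ)ᵀ V⁻¹ (x - μ)`, so are the scores of its
submodels, and hence the residuals are orthogonal to its tangent space. -/
theorem tangent_le (h : IsTrueParam S V A s g) {F : Set ((Fin m → ℝ) → ℝ)}
    (hF : ∀ p ∈ F, ∀ x x', quadInv V (x - μ) = quadInv V (x' - μ) → p x = p x') (i : GammaIdx m) :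
    tangent F (pdfC S (gammaOf μ V) s g) ≤ orthTo (h.memLp_residual (μ := μ) i) := by
  refine Submodule.topologicalClosure_minimal _ (Submodule.span_le.2 ?_) (isClosed_orthTo _)
  rintro w ⟨r, q, ρ₀, j, hq, hw⟩
  have hrad : Radial (score q ρ₀ j ∘ affine μ A) := by
    intro y y' hy
    have hquad : quadInv V (affine μ A y - μ) = quadInv V (affine μ A y' - μ) := by
      have h1 := h.stdSq_affine (μ := μ) y
      rw [hy, ← h.stdSq_affine (μ := μ) y'] at h1
      exact mul_left_cancel₀ (inv_ne_zero h.pos.ne') h1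
    have hup : Tendsto (fun t => Function.update ρ₀ j t) (𝓝 (ρ₀ j)) (𝓝 ρ₀) := by
      have : Continuous (fun t => Function.update ρ₀ j t) :=
        continuous_const.update j continuous_id
      simpa using this.tendsto (ρ₀ j)
    have hev : (fun t => Real.log (q (Function.update ρ₀ j t) (affine μ A y))) =ᶠ[𝓝 (ρ₀ j)]
        fun t => Real.log (q (Function.update ρ₀ j t) (affine μ A y')) := by
      filter_upwards [hup.eventually hq.mem] with t ht
      rw [hF _ ht _ _ hquad]
    exact hev.deriv_eq
  have hwy : w ∘ affine μ A =ᵐ[sphLaw m g] score q ρ₀ j ∘ affine μ A :=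
    (h.measurePreserving (μ := μ)).quasiMeasurePreserving.ae_eq_comp hw
  exact (mem_orthTo (h.memLp_residual (μ := μ) i)).2
    (h.integral_residual_mul i (Lp.memLp w) hrad hwy)

theorem pdfU_congr (h : IsTrueParam S V A s g) (G : ℝ → ℝ) {x x' : Fin m → ℝ}
    (hx : quadInv V (x - μ) = quadInv V (x' - μ)) :
    pdfU S (gammaOf μ V) G x = pdfU S (gammaOf μ V) G x' := by
  have h1 : gammaOf μ V ∘ Sum.inr = ovecs V := rfl
  have h2 : gammaOf μ V ∘ Sum.inl = μ := rfl
  simp only [pdfU, h1, h2, shapeMat_ovecs h.isScale h.posDef h.shape, hx]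

theorem pdfC_congr (h : IsTrueParam S V A s g) (G : ℝ → ℝ) {x x' : Fin m → ℝ}
    (hx : quadInv V (x - μ) = quadInv V (x' - μ)) :
    pdfC S (gammaOf μ V) s G x = pdfC S (gammaOf μ V) s G x' := by
  simp only [pdfC_gammaOf h.isScale h.posDef h.shape, hx]

/-- Bounded centred functions of the standardized squared distance are scores of regular submodels
of the unconstrained model: the submodel multiplies the generator by `1 + ρ f`. -/
theorem toLp_mem_tangent (h : IsTrueParam S V A s g) {f : ℝ → ℝ} (hf : Measurable f) {C : ℝ}
    (hC : ∀ q, |f q| ≤ C) (h0 : ∫ q, f q ∂modularLaw m g = 0)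
    (hfN : MemLp (f ∘ stdSq μ V s) 2 (law (pdfC S (gammaOf μ V) s g))) :
    hfN.toLp _ ∈ tangent (pdfU S (gammaOf μ V) '' Gen m) (pdfC S (gammaOf μ V) s g) := by
  have := isProbabilityMeasure_modularLaw h.gen.mem
  have hi : Integrable f (modularLaw m g) :=
    (integrable_const C).mono' hf.aestronglyMeasurable (.of_forall hC)
  refine Submodule.le_topologicalClosure _ (Submodule.subset_span
    ⟨1, fun ρ => pdfC S (gammaOf μ V) s fun t => g t * (1 + ρ 0 * f t), 0, 0, ?_, ?_⟩)
  · have hval : ∀ (ρ : Fin 1 → ℝ) x, pdfC S (gammaOf μ V) s (fun t => g t * (1 + ρ 0 * f t)) x =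
        pdfC S (gammaOf μ V) s g x * (1 + ρ 0 * f (stdSq μ V s x)) := by
      intro ρ x
      simp only [pdfC_gammaOf h.isScale h.posDef h.shape, stdSq]
      ring
    refine ⟨?_, ?_, ?_, ?_⟩
    · have hev : ∀ᶠ ρ : Fin 1 → ℝ in 𝓝 0, |ρ 0| * C < 1 := by
        have : Continuous fun ρ : Fin 1 → ℝ => |ρ 0| * C := by fun_prop
        exact this.continuousAt.eventually (gt_mem_nhds (by simp))
      filter_upwards [hev] with ρ hρ
      exact ⟨_, rescale_mem_gen h.pos
        (perturb_mem_gen h.gen.mem h.gen.continuousOn hC hi h0 hρ.le), pdfU_rescale _ _ _⟩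
    · simp
    · refine .of_forall fun x => ?_
      simp only [hval]
      fun_prop
    · refine ⟨fun x => |f (stdSq μ V s x)|, hfN.abs, .of_forall fun ρ => ?_⟩
      filter_upwards [h.ae_stdSq (μ := μ)] with x hx
      have hp : 0 ≤ pdfC S (gammaOf μ V) s g x := by
        rw [pdfC_gammaOf h.isScale h.posDef h.shape]
        have := hx.2
        have := h.pos
        have := h.posDef.det_pos
        unfold stdSq at *
        positivity
      have h1 : |ρ 0| ≤ ‖ρ - 0‖ := by
        rw [sub_zero]; exact norm_le_pi_norm ρ 0
      rw [hval]
      have h2 : pdfC S (gammaOf μ V) s g x * (1 + ρ 0 * f (stdSq μ V s x)) -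
          pdfC S (gammaOf μ V) s g x =
          ρ 0 * f (stdSq μ V s x) * pdfC S (gammaOf μ V) s g x := by ring
      rw [h2, abs_mul, abs_mul, abs_of_nonneg hp]
      gcongr
  · filter_upwards [hfN.coeFn_toLp, h.ae_stdSq (μ := μ)] with x hx hpos
    rw [hx]
    have hp : pdfC S (gammaOf μ V) s g x ≠ 0 := by
      rw [pdfC_gammaOf h.isScale h.posDef h.shape]
      have := hpos.2
      have := h.pos
      have := h.posDef.det_pos
      unfold stdSq at *
      positivity
    have hval : ∀ t : ℝ, pdfC S (gammaOf μ V) s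
        (fun q => g q * (1 + Function.update (0 : Fin 1 → ℝ) 0 t 0 * f q)) x =
        pdfC S (gammaOf μ V) s g x * (1 + t * f (stdSq μ V s x)) := by
      intro t
      simp only [pdfC_gammaOf h.isScale h.posDef h.shape, stdSq, Function.update_self]
      ring
    simp only [score, hval]
    have hd : HasDerivAt (fun t : ℝ => pdfC S (gammaOf μ V) s g x * (1 + t * f (stdSq μ V s x)))
        (pdfC S (gammaOf μ V) s g x * (1 * f (stdSq μ V s x))) 0 :=
      (((hasDerivAt_id (0 : ℝ)).mul_const _).const_add 1).const_mul _
    have hd2 := hd.log (by simpa using hp)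
    rw [Pi.zero_apply, hd2.deriv]
    simp
    field_simp

/-- The score of the scale belongs to the tangent space of the unconstrained generator: it is a
centred function of the standardized squared distance, hence an `L²` limit of bounded ones. -/
theorem scoreS_mem_tangent (h : IsTrueParam S V A s g) :
    toL2 (law (pdfC S (gammaOf μ V) s g)) (scoreS S (gammaOf μ V) s g) ∈
      tangent (pdfU S (gammaOf μ V) '' Gen m) (pdfC S (gammaOf μ V) s g) := by
  have := isProbabilityMeasure_modularLaw h.gen.mem
  have hPr := h.isProbabilityMeasure (μ := μ)
  set f : ℝ → ℝ := fun q => (2 * s)⁻¹ * (q * phi g q - m) with hf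
  have hf2 : MemLp f 2 (modularLaw m g) :=
    ((memLp_mul_phi h.gen.continuousOn h.gen.integrable_alpha).sub (memLp_const (m : ℝ))).const_mul _
  have hmp := h.measurePreserving_stdSq (μ := μ)
  rw [toL2_eq h.memLp_scoreS, tangent, ← SetLike.mem_coe, Submodule.topologicalClosure_coe,
    ← closure_closure, ← Submodule.topologicalClosure_coe]
  refine EMetric.mem_closure_iff.2 fun ε hε => ?_
  obtain ⟨u, hu, hu2⟩ := hf2.exists_simpleFunc_eLpNorm_sub_lt (by simp)
    (ε := ε / 2) (ENNReal.half_pos hε.ne').ne'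
  set c : ℝ := ∫ q, u q ∂modularLaw m g with hc
  obtain ⟨K, hK⟩ := u.exists_forall_norm_le
  have hui : Integrable u (modularLaw m g) := hu2.integrable one_le_two
  have hk2 : MemLp (fun q => u q - c) 2 (modularLaw m g) := hu2.sub (memLp_const c)
  have hkN := hk2.comp_measurePreserving hmp
  refine ⟨hkN.toLp _, h.toLp_mem_tangent (u.measurable.sub_const c) (C := K + |c|) (fun q => ?_) ?_
    hkN, ?_⟩
  · exact (abs_sub _ _).trans (add_le_add_left (hK q) _)
  · rw [integral_sub hui (integrable_const c)]; simp [hc]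
  · have hsub : MemLp (f - ⇑u) 2 (modularLaw m g) := hf2.sub hu2
    have hcle : ‖c‖ₑ ≤ eLpNorm (f - ⇑u) 2 (modularLaw m g) := by
      have h1 : ‖c‖ₑ = ‖∫ q, (f - ⇑u) q ∂modularLaw m g‖ₑ := by
        simp only [Pi.sub_apply]
        rw [integral_sub (hf2.integrable one_le_two) hui, h.integral_modular_score, zero_sub,
          enorm_neg]
      rw [h1]
      refine (enorm_integral_le_lintegral_enorm _).trans ?_
      rw [← eLpNorm_one_eq_lintegral_enorm]
      exact eLpNorm_le_eLpNorm_of_exponent_le one_le_two hsub.1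
    have hedist : edist ((h.memLp_scoreS (μ := μ)).toLp _) (hkN.toLp _) =
        eLpNorm ((f - ⇑u) + fun _ => c) 2 (modularLaw m g) := by
      rw [Lp.edist_toLp_toLp, ← eLpNorm_comp_measurePreserving (hsub.1.add
        aestronglyMeasurable_const) hmp]
      refine eLpNorm_congr_ae ?_
      filter_upwards [h.scoreS_ae (μ := μ)] with x hx
      simp only [Pi.sub_apply, Function.comp_apply, Pi.add_apply, hx, hf]
      ring
    rw [hedist]
    calc eLpNorm ((f - ⇑u) + fun _ => c) 2 (modularLaw m g)
        ≤ eLpNorm (f - ⇑u) 2 (modularLaw m g) + eLpNorm (fun _ => c) 2 (modularLaw m g) :=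
          eLpNorm_add_le hsub.1 aestronglyMeasurable_const one_le_two
      _ ≤ eLpNorm (f - ⇑u) 2 (modularLaw m g) + eLpNorm (f - ⇑u) 2 (modularLaw m g) := by
          gcongr
          rw [eLpNorm_const' _ (by simp) (by simp)]
          simpa using hcle
      _ < ε / 2 + ε / 2 := ENNReal.add_lt_add hu hu
      _ = ε := ENNReal.add_halves ε

end IsTrueParam

end Tangent

/-! ### The information matrices -/

section Final

variable {m : ℕ} [NeZero m] {S : Matrix (Fin m) (Fin m) ℝ → ℝ} {μ : Fin m → ℝ}
  {V A : Matrix (Fin m) (Fin m) ℝ} {s : ℝ} {g : ℝ → ℝ}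

theorem MMat_row (k : OffIdx m) : MMat S V k = Matrix.vec (shapeDeriv S V k) := by
  ext ⟨i, j⟩
  have h := (symMat_isSymm fun l => KMat S V l k).apply j i
  change MMat S V k (i, j) = symMat (fun l => KMat S V l k) j i
  rw [← h]
  simp [MMat, Matrix.mul_apply, dupMat, symMat]

theorem stdDeriv_isSymm (k : OffIdx m) : (stdDeriv S V A s k).IsSymm := by
  have hsym : (shapeDeriv S V k).IsSymm := symMat_isSymm _
  rw [Matrix.IsSymm, stdDeriv, Matrix.transpose_smul, Matrix.transpose_mul, Matrix.transpose_mul,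
    Matrix.transpose_transpose, hsym.eq, Matrix.mul_assoc]

theorem infoShape_apply (hV : V.PosDef) (k l : OffIdx m) :
    infoShape S V g k l = 2⁻¹ * alpha m g *
      ((V⁻¹ * shapeDeriv S V k * V⁻¹ * shapeDeriv S V l).trace -
        (m : ℝ)⁻¹ * ((V⁻¹ * shapeDeriv S V k).trace * (V⁻¹ * shapeDeriv S V l).trace)) := by
  have hVs : V⁻¹ᵀ = V⁻¹ := by
    rw [Matrix.transpose_nonsing_inv, (isSymm_of_posDef hV).eq]
  have hsym : (shapeDeriv S V k).IsSymm := symMat_isSymm _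
  have h1 : (MMat S V * (V⁻¹ ⊗ₖ V⁻¹ - (m : ℝ)⁻¹ • Matrix.vecMulVec (Matrix.vec V⁻¹) (Matrix.vec V⁻¹)) *
      (MMat S V)ᵀ) k l = Matrix.vec (shapeDeriv S V k) ⬝ᵥ ((V⁻¹ ⊗ₖ V⁻¹ - (m : ℝ)⁻¹ •
        Matrix.vecMulVec (Matrix.vec V⁻¹) (Matrix.vec V⁻¹)) *ᵥ Matrix.vec (shapeDeriv S V l)) := by
    rw [← MMat_row, ← MMat_row, Matrix.mul_assoc, Matrix.mul_apply']
    rfl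
  rw [infoShape, Matrix.smul_apply, h1, smul_eq_mul, Matrix.sub_mulVec, Matrix.smul_mulVec,
    Matrix.kronecker_mulVec_vec, Matrix.vecMulVec_mulVec, dotProduct_sub, dotProduct_smul,
    Matrix.vec_dotProduct_vec, Matrix.vec_dotProduct_vec, hsym.eq]
  congr 2
  · rw [hVs, Matrix.trace_mul_comm, Matrix.mul_assoc, Matrix.trace_mul_comm, ← Matrix.mul_assoc]
  · rw [op_smul_eq_smul, dotProduct_smul, Matrix.vec_dotProduct_vec, hsym.eq, hVs, smul_eq_mul,
      smul_eq_mul, Matrix.trace_mul_comm (shapeDeriv S V k)]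
    ring

namespace IsTrueParam

/-- The common value of the three information matrices. -/
theorem effInfo_eq (h : IsTrueParam S V A s g)
    {T : Submodule ℝ (Lp ℝ 2 (law (pdfC S (gammaOf μ V) s g)))}
    (hmem : toL2 (law (pdfC S (gammaOf μ V) s g)) (scoreS S (gammaOf μ V) s g) ∈
      T.topologicalClosure)
    (horth : ∀ i, T ≤ orthTo (h.memLp_residual (μ := μ) i)) :
    effInfo (scoreC S (gammaOf μ V) s g) T =
      Matrix.fromBlocks (infoMu s V g) 0 0 (infoShape S V g) := by
  have hblock : Matrix.fromBlocks (infoMu s V g) 0 0 (infoShape S V g) =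
      Matrix.fromBlocks (beta m g • ((A⁻¹)ᵀ * ((A⁻¹)ᵀ)ᵀ)) 0 0
        (Matrix.of fun k l => 2⁻¹ * alpha m g *
          ((stdDeriv S V A s k * stdDeriv S V A s l).trace - (m : ℝ)⁻¹ *
            ((stdDeriv S V A s k).trace * (stdDeriv S V A s l).trace))) := by
    congr 1
    · rw [infoMu, h.root.inv_smul, Matrix.transpose_transpose]
    · ext k l
      have h1 : (stdDeriv S V A s k * stdDeriv S V A s l).trace =
          (V⁻¹ * shapeDeriv S V k * V⁻¹ * shapeDeriv S V l).trace := by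
        rw [h.root.inv_eq h.pos, stdDeriv, stdDeriv]
        simp only [Matrix.smul_mul, Matrix.mul_smul, Matrix.trace_smul, Matrix.mul_assoc]
        rw [Matrix.trace_mul_comm (A⁻¹)ᵀ]
        simp only [Matrix.mul_assoc]
      rw [Matrix.of_apply, infoShape_apply h.posDef, h1, h.root.trace_inv_mul h.pos,
        h.root.trace_inv_mul h.pos, stdDeriv, stdDeriv]
  rw [hblock]
  ext i j
  rw [effInfo_apply (fun i => h.memLp_scoreC i) h.memLp_scoreS (fun i => h.memLp_residual i) hmem
    horth, ← integral_stdEff_mul_stdEff h.gen stdDeriv_isSymm, ← h.integral_comp]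
  refine integral_congr_ae ?_
  filter_upwards [h.residual_affine_ae (μ := μ) i, h.residual_affine_ae (μ := μ) j] with y h1 h2
  rw [← h1, ← h2]
  rfl

theorem infoS_eq (h : IsTrueParam S V A s g) :
    infoS S (gammaOf μ V) s g = Matrix.fromBlocks (infoMu s V g) 0 0 (infoShape S V g) :=
  h.effInfo_eq (Submodule.le_topologicalClosure _ scoreS_mem_tangentS) h.tangentS_le

theorem infoC_eq (h : IsTrueParam S V A s g) :
    infoC S (gammaOf μ V) s g = Matrix.fromBlocks (infoMu s V g) 0 0 (infoShape S V g) := by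
  refine h.effInfo_eq (Submodule.le_topologicalClosure _ (Submodule.mem_sup_left
    scoreS_mem_tangentS)) fun i => sup_le (h.tangentS_le i) (h.tangent_le ?_ i)
  rintro _ ⟨G, -, rfl⟩ x x' hx
  exact h.pdfC_congr G hx

theorem infoU_eq (h : IsTrueParam S V A s g) :
    infoU S (gammaOf μ V) (rescale m s g) =
      Matrix.fromBlocks (infoMu s V g) 0 0 (infoShape S V g) := by
  rw [infoU, tangentU, scoreU_rescale, pdfU_rescale]
  refine h.effInfo_eq (Submodule.le_topologicalClosure _ h.scoreS_mem_tangent)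
    (h.tangent_le ?_)
  rintro _ ⟨G, -, rfl⟩ x x' hx
  exact h.pdfU_congr G hx

end IsTrueParam

end Final

end Elliptical

end

open Elliptical
theorem proposition1 {m : ℕ} [NeZero m]
    (S : Matrix (Fin m) (Fin m) ℝ → ℝ) (hS : IsScale S)
    (μ₀ : Fin m → ℝ) (V₀ : Matrix (Fin m) (Fin m) ℝ) (hV₀ : V₀.PosDef) (hSV₀ : S V₀ = 1)
    (s₀ : ℝ) (hs₀ : 0 < s₀)
    (g : ℝ → ℝ) (hg : g ∈ GenC m) (hg1 : ContDiffOn ℝ 1 g (Set.Ioi 0))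
    (hQ2 : MeasureTheory.Integrable (fun q : ℝ => q ^ 2) (modularLaw m g))
    (hα : MeasureTheory.Integrable (fun q : ℝ => q ^ 2 * phi g q ^ 2) (modularLaw m g))
    (hβ : MeasureTheory.Integrable (fun q : ℝ => q * phi g q ^ 2) (modularLaw m g)) :
    (∀ i, InH (law (pdfU S (gammaOf μ₀ V₀) (rescale m s₀ g)))
        (scoreU S (gammaOf μ₀ V₀) (rescale m s₀ g) i)) ∧
    (∀ i, InH (law (pdfC S (gammaOf μ₀ V₀) s₀ g)) (scoreC S (gammaOf μ₀ V₀) s₀ g i)) ∧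
    InH (law (pdfC S (gammaOf μ₀ V₀) s₀ g)) (scoreS S (gammaOf μ₀ V₀) s₀ g) ∧
    infoU S (gammaOf μ₀ V₀) (rescale m s₀ g) = infoC S (gammaOf μ₀ V₀) s₀ g ∧
    infoC S (gammaOf μ₀ V₀) s₀ g = infoS S (gammaOf μ₀ V₀) s₀ g ∧
    infoS S (gammaOf μ₀ V₀) s₀ g =
      Matrix.fromBlocks (infoMu s₀ V₀ g) 0 0 (infoShape S V₀ g) := by
  obtain ⟨A, hA⟩ := exists_isRoot hV₀ hs₀
  have h : IsTrueParam S V₀ A s₀ g := ⟨hS, hV₀, hSV₀, hs₀, hA, ⟨hg.1, hg1, hα, hβ⟩⟩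
  rw [scoreU_rescale, pdfU_rescale, h.infoU_eq, h.infoC_eq, h.infoS_eq]
  exact ⟨fun i => ⟨h.memLp_scoreC i, h.integral_scoreC i⟩,
    fun i => ⟨h.memLp_scoreC i, h.integral_scoreC i⟩, ⟨h.memLp_scoreS, h.integral_scoreS⟩,
    rfl, rfl, rfl⟩
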